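/- Let $X\subset\mathbb R$ be a finite set. Let $A$ be a Schrödinger operator with local interactions on $X$, that is, a self-adjoint operator on $L_2(\mathbb R)$ which extends the minimal operator $\varphi\mapsto-\varphi''$, $\varphi\in C_0^\infty(\mathbb R\setminus X)$, and which has the following property: if $u\in\mathfrak D(A)$, then $\chi u\in\mathfrak D(A)$ for every $\chi\in C_0^\infty(\mathbb R)$ with $\chi'\in C_0^\infty(\mathbb R\setminus X)$. We say that $A$ describes a $\delta'$-interaction on $X$ if there are real intensities $\beta_x$, $x\in X$ (zero being allowed), such that $\mathfrak D(A)$ consists of all functions $\psi\in W_2^2(\mathbb R\setminus X)$ with $$\psi'(x+0)-\psi'(x-0)=0,\qquad \psi(x+0)-\psi(x-0)=\beta_x\,\tfrac12\big[\psi'(x+0)+\psi'(x-0)\big]\qquad\text{for every }x\in X,$$ and $A\psi=-\psi''$ on $\mathbb R\setminus X$ for $\psi\in\mathfrak D(A)$. Then $A$ describes a $\delta'$-interaction on $X$ if and only if both of the following conditions hold: 1. every $\chi\in C_0^\infty(\mathbb R)$ with $\chi'\in C_0^\infty(\mathbb R\setminus X)$ belongs to $\mathfrak D(A)$; 2. for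 no $a\in\mathbb R$ does $A$ admit a representation as a direct sum $A=A_1\oplus A_2$ of self-adjoint operators $A_1$ on $L_2(-\infty,a)$ and $A_2$ on $L_2(a,+\infty)$, where $L_2(\mathbb R)=L_2(-\infty,a)\oplus L_2(a,+\infty)$. -/

import Mathlib

open MeasureTheory Filter Topology
open scoped ContDiff

namespace PointInteraction

/-- The Hilbert space `L₂(ℝ)` of complex-valued square-integrable functions. -/
abbrev L2R : Type := Lp ℂ 2 (volume : Measure ℝ)

/-- `φ ∈ C₀^∞(U)`: `φ` is smooth on `ℝ` and has compact support contained in `U`. -/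
structure IsTestFunction (U : Set ℝ) (φ : ℝ → ℂ) : Prop where
  smooth : ContDiff ℝ ∞ φ
  compact_support : HasCompactSupport φ
  support_subset : tsupport φ ⊆ U

/-- A cutting function for `X`: `χ ∈ C₀^∞(ℝ)` with `χ' ∈ C₀^∞(ℝ ∖ X)`. -/
def IsCutoff (X : Set ℝ) (χ : ℝ → ℂ) : Prop :=
  IsTestFunction Set.univ χ ∧ IsTestFunction Xᶜ (deriv χ)

/-- The (a.e. class of the) function `f` belongs to the domain of the operator `A`. -/
def MemDomain (A : L2R →ₗ.[ℂ] L2R) (f : ℝ → ℂ) : Prop :=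
  ∃ u : L2R, u ∈ A.domain ∧ ⇑u =ᵐ[volume] f

/-- `A` extends the minimal operator `φ ↦ -φ''` with domain `C₀^∞(ℝ ∖ X)`. -/
def ExtendsMinimal (X : Set ℝ) (A : L2R →ₗ.[ℂ] L2R) : Prop :=
  ∀ φ : ℝ → ℂ, IsTestFunction Xᶜ φ →
    ∃ u v : L2R, (u, v) ∈ A.graph ∧ ⇑u =ᵐ[volume] φ ∧
      ⇑v =ᵐ[volume] fun x => -deriv (deriv φ) x

/-- `A` is a one-dimensional Schrödinger operator with local interactions on `X`: a self-adjoint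
extension of the minimal operator on `ℝ ∖ X` whose domain is invariant under multiplication by
all cutting functions for `X`. -/
structure IsLocalInteraction (X : Set ℝ) (A : L2R →ₗ.[ℂ] L2R) : Prop where
  selfAdjoint : IsSelfAdjoint A
  extends_minimal : ExtendsMinimal X A
  isLocal : ∀ u : L2R, u ∈ A.domain → ∀ χ : ℝ → ℂ, IsCutoff X χ →
    MemDomain A (fun x => χ x * u x)

/-- `g` is the weak derivative of `u` on `ℝ ∖ X`. -/
def IsWeakDeriv (X : Set ℝ) (u g : L2R) : Prop :=
  ∀ φ : ℝ → ℂ, IsTestFunction Xᶜ φ → ∫ x, u x * deriv φ x = -∫ x, g x * φ x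

/-- `u ∈ W₂²(ℝ ∖ X)`, with first weak derivative `g` and second weak derivative `h`
(all three in `L₂(ℝ)`). -/
structure IsW22 (X : Set ℝ) (u g h : L2R) : Prop where
  weak_deriv : IsWeakDeriv X u g
  weak_deriv_two : IsWeakDeriv X g h

/-- `u(x₀ + 0) = c`, as an essential limit: it does not depend on the representative of `u`, and
it is the usual one-sided limit of a representative that is continuous on the right of `x₀`. -/
def HasRightValue (u : L2R) (x₀ : ℝ) (c : ℂ) : Prop :=
  Tendsto u (𝓝[>] x₀ ⊓ ae volume) (𝓝 c)

/-- `u(x₀ - 0) = c`, as an essential limit. -/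
def HasLeftValue (u : L2R) (x₀ : ℝ) (c : ℂ) : Prop :=
  Tendsto u (𝓝[<] x₀ ⊓ ae volume) (𝓝 c)

/-- The boundary conditions of a `δ'`-interaction of intensity `β` at `x₀`, for a function `u` with
derivative `g`: `u'(x₀+0) - u'(x₀-0) = 0` and
`u(x₀+0) - u(x₀-0) = β · (u'(x₀+0) + u'(x₀-0)) / 2`. -/
def DeltaPrimeCondition (β x₀ : ℝ) (u g : L2R) : Prop :=
  ∃ u₁ u₀ g₁ g₀ : ℂ,
    HasRightValue u x₀ u₁ ∧ HasLeftValue u x₀ u₀ ∧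
    HasRightValue g x₀ g₁ ∧ HasLeftValue g x₀ g₀ ∧
    g₁ - g₀ = 0 ∧ u₁ - u₀ = (β : ℂ) * ((g₁ + g₀) / 2)

/-- `A` describes a `δ'`-interaction on `X`: for some real intensities `β x`, `x ∈ X`, the operator
`A` is `u ↦ -u''` on the domain of all `u ∈ W₂²(ℝ ∖ X)` that satisfy the boundary conditions of a
`δ'`-interaction of intensity `β x` at every `x ∈ X`. -/
def IsDeltaPrimeInteraction (X : Set ℝ) (A : L2R →ₗ.[ℂ] L2R) : Prop :=
  ∃ β : ℝ → ℝ, ∀ u v : L2R, (u, v) ∈ A.graph ↔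
    ∃ g : L2R, IsW22 X u g (-v) ∧ ∀ x ∈ X, DeltaPrimeCondition (β x) x u g

/-- The restriction map `L₂(ℝ) → L₂(S)`. -/
noncomputable abbrev restrictL2 (S : Set ℝ) :
    L2R →L[ℂ] Lp ℂ 2 ((volume : Measure ℝ).restrict S) :=
  LpToLpRestrictCLM ℝ ℂ ℂ volume 2 S

/-- `A = A₁ ⊕ A₂` for some self-adjoint operators `A₁` on `L₂(-∞, a)` and `A₂` on `L₂(a, ∞)`, under
the identification `L₂(ℝ) = L₂(-∞, a) ⊕ L₂(a, ∞)`. -/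
def SplitsAt (A : L2R →ₗ.[ℂ] L2R) (a : ℝ) : Prop :=
  ∃ (A₁ : Lp ℂ 2 ((volume : Measure ℝ).restrict (Set.Iio a)) →ₗ.[ℂ]
        Lp ℂ 2 ((volume : Measure ℝ).restrict (Set.Iio a)))
    (A₂ : Lp ℂ 2 ((volume : Measure ℝ).restrict (Set.Ioi a)) →ₗ.[ℂ]
        Lp ℂ 2 ((volume : Measure ℝ).restrict (Set.Ioi a))),
    IsSelfAdjoint A₁ ∧ IsSelfAdjoint A₂ ∧
    ∀ u v : L2R, (u, v) ∈ A.graph ↔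
      (restrictL2 (Set.Iio a) u, restrictL2 (Set.Iio a) v) ∈ A₁.graph ∧
      (restrictL2 (Set.Ioi a) u, restrictL2 (Set.Ioi a) v) ∈ A₂.graph

end PointInteraction

/-! Since `A` is self-adjoint and extends the minimal operator, every `u` in its domain lies in
`W₂²(ℝ ∖ X)` with `A u = -u''` (`exists_isW22`), so `u` and `u'` have one-sided limits everywhere.
Green's formula expresses the boundary form of two such functions through the jumps on `X` of the
Wronskian `u' p̄ - u p̄'`. Self-adjointness makes the total zero, and cutoffs isolate one point at a
time, so on the domain the Wronskian has no jump at all (`wronskian_eq`). Conversely, a function of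
`W₂²(ℝ ∖ X)` whose Wronskian with each element of the domain has no jump is itself in the domain
(`mem_graph_of_wronskian_eq`).

Assume the two conditions. A cutoff equal to `1` near `a` has Wronskian `u'` with `u`, so `u'` is
continuous at `a`. Writing `[u]` for the jump of `u` at `a`, the Wronskian identity for `u`, `u₀`
becomes `u'(a) · conj [u₀] = [u] · conj u₀'(a)`. If `u'(a) = 0` on the whole domain, Neumann
conditions hold on both sides of `a ∈ X` and `A` splits there, which is excluded. Otherwise some
`u₀` has `u₀'(a) ≠ 0`; the identity for the pair `u₀`, `u₀` shows that `β = [u₀] / u₀'(a)` is real,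
and then `[u] = β u'(a)` for every `u` (`exists_intensity`).

For a `δ'`-interaction, cutoffs satisfy the boundary conditions because they are constant near each
point of `X`. If `A` split at `a`, truncating at `a` a cutoff equal to `1` near `a` would stay in
the domain; but the result jumps at `a` while its derivative vanishes on both sides
(`not_splitsAt`). -/

namespace PointInteraction

/-! ### Primitives of locally integrable functions and integration by parts -/

/-- The primitive of `f` with value `c` at the origin. -/
noncomputable def primitive (c : ℂ) (f : ℝ → ℂ) (x : ℝ) : ℂ := c + ∫ t in (0 : ℝ)..x, f t

theorem _root_.MeasureTheory.LocallyIntegrable.intervalIntegrable' {f : ℝ → ℂ}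
    (hf : LocallyIntegrable f) (a b : ℝ) : IntervalIntegrable f volume a b :=
  (hf.integrableOn_isCompact isCompact_uIcc).intervalIntegrable

theorem continuous_primitive (c : ℂ) {f : ℝ → ℂ} (hf : LocallyIntegrable f) :
    Continuous (primitive c f) :=
  continuous_const.add (intervalIntegral.continuous_primitive hf.intervalIntegrable' 0)

theorem primitive_sub (c : ℂ) {f : ℝ → ℂ} (hf : LocallyIntegrable f) (a b : ℝ) :
    primitive c f b - primitive c f a = ∫ t in a..b, f t := by
  rw [primitive, primitive, add_sub_add_left_eq_sub,
    intervalIntegral.integral_interval_sub_left (hf.intervalIntegrable' _ _)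
      (hf.intervalIntegrable' _ _)]

theorem primitive_eq (c : ℂ) {f : ℝ → ℂ} (hf : LocallyIntegrable f) (a x : ℝ) :
    primitive c f x = primitive c f a + ∫ t in a..x, f t := by
  rw [← primitive_sub c hf]; ring

theorem hasDerivAt_primitive (c : ℂ) {f : ℝ → ℂ} (hf : Continuous f) (x : ℝ) :
    HasDerivAt (primitive c f) (f x) x :=
  (intervalIntegral.integral_hasDerivAt_right (hf.intervalIntegrable _ _)
    (hf.stronglyMeasurableAtFilter _ _) hf.continuousAt).const_add c

/-- Primitives of integrable functions are absolutely continuous and have the integrand as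
derivative almost everywhere, so this is the product rule integrated. -/
theorem integral_mul_primitive_real {f g : ℝ → ℝ} {a b : ℝ} (hf : IntervalIntegrable f volume a b)
    (hg : IntervalIntegrable g volume a b) (c d : ℝ) :
    ∫ x in a..b, (f x * (d + ∫ t in a..x, g t) + (c + ∫ t in a..x, f t) * g x) =
      (c + ∫ t in a..b, f t) * (d + ∫ t in a..b, g t) - c * d := by
  have key : ∀ (h : ℝ → ℝ) (e : ℝ), IntervalIntegrable h volume a b →
      AbsolutelyContinuousOnInterval (fun x => e + ∫ t in a..x, h t) a b ∧
      ∀ᵐ x, x ∈ Set.uIcc a b → deriv (fun x => e + ∫ t in a..x, h t) x = h x := by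
    intro h e hh
    refine ⟨?_, ?_⟩
    · have h1 : AbsolutelyContinuousOnInterval (fun _ : ℝ => e) a b :=
        (LipschitzWith.const e).lipschitzOnWith.absolutelyContinuousOnInterval
      exact h1.add (hh.absolutelyContinuousOnInterval_intervalIntegral Set.left_mem_uIcc)
    · filter_upwards [hh.ae_hasDerivAt_integral] with x hx hxm
      exact ((hx hxm a Set.left_mem_uIcc).const_add e).deriv
  obtain ⟨hf1, hf2⟩ := key f c hf
  obtain ⟨hg1, hg2⟩ := key g d hg
  have := hf1.integral_deriv_mul_eq_sub hg1
  simp only [intervalIntegral.integral_same, add_zero] at this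
  rw [← this]
  refine intervalIntegral.integral_congr_ae ?_
  filter_upwards [hf2, hg2] with x h1 h2 hx
  rw [h1 (Set.uIoc_subset_uIcc hx), h2 (Set.uIoc_subset_uIcc hx)]

/-- Integration by parts for absolutely continuous functions. -/
theorem integral_mul_primitive {f g : ℝ → ℂ} (hf : LocallyIntegrable f) (hg : LocallyIntegrable g)
    (c d : ℂ) (a b : ℝ) :
    ∫ x in a..b, (f x * primitive d g x + primitive c f x * g x) =
      primitive c f b * primitive d g b - primitive c f a * primitive d g a := by
  have hfi := hf.intervalIntegrable' a b
  have hgi := hg.intervalIntegrable' a b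
  have re_int : ∀ {h : ℝ → ℂ}, IntervalIntegrable h volume a b →
      IntervalIntegrable (fun x => (h x).re) volume a b := fun hh => ⟨hh.1.re, hh.2.re⟩
  have im_int : ∀ {h : ℝ → ℂ}, IntervalIntegrable h volume a b →
      IntervalIntegrable (fun x => (h x).im) volume a b := fun hh => ⟨hh.1.im, hh.2.im⟩
  have hre : ∀ {h : ℝ → ℂ}, LocallyIntegrable h → ∀ e x,
      (primitive e h x).re = (primitive e h a).re + ∫ t in a..x, (h t).re := by
    intro h hh e x
    rw [primitive_eq e hh a x, Complex.add_re]
    congr 1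
    have := Complex.reCLM.intervalIntegral_comp_comm (hh.intervalIntegrable' a x)
    simpa using this.symm
  have him : ∀ {h : ℝ → ℂ}, LocallyIntegrable h → ∀ e x,
      (primitive e h x).im = (primitive e h a).im + ∫ t in a..x, (h t).im := by
    intro h hh e x
    rw [primitive_eq e hh a x, Complex.add_im]
    congr 1
    have := Complex.imCLM.intervalIntegral_comp_comm (hh.intervalIntegrable' a x)
    simpa using this.symm
  have hint : IntervalIntegrable (fun x => f x * primitive d g x + primitive c f x * g x)
      volume a b :=
    (hfi.mul_continuousOn (continuous_primitive d hg).continuousOn).add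
      (hgi.continuousOn_mul (continuous_primitive c hf).continuousOn)
  have cont : ∀ {h : ℝ → ℂ}, LocallyIntegrable h → ∀ e, Continuous (primitive e h) :=
    fun hh e => continuous_primitive e hh
  have I1 : ∀ {p q : ℝ → ℝ} {P Q : ℝ → ℝ}, IntervalIntegrable p volume a b →
      IntervalIntegrable q volume a b → Continuous P → Continuous Q →
      IntervalIntegrable (fun x => p x * Q x + P x * q x) volume a b :=
    fun hp hq hP hQ => (hp.mul_continuousOn hQ.continuousOn).add
      (hq.continuousOn_mul hP.continuousOn)
  have E : ∀ {p q : ℝ → ℝ} {P Q : ℝ → ℝ}, IntervalIntegrable p volume a b →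
      IntervalIntegrable q volume a b → (∀ x, P x = P a + ∫ t in a..x, p t) →
      (∀ x, Q x = Q a + ∫ t in a..x, q t) →
      ∫ x in a..b, (p x * Q x + P x * q x) = P b * Q b - P a * Q a := by
    intro p q P Q hp hq hP hQ
    have := integral_mul_primitive_real hp hq (P a) (Q a)
    simp only [← hP, ← hQ] at this
    exact this
  have crF : Continuous fun x => (primitive c f x).re := Complex.continuous_re.comp (cont hf c)
  have ciF : Continuous fun x => (primitive c f x).im := Complex.continuous_im.comp (cont hf c)
  have crG : Continuous fun x => (primitive d g x).re := Complex.continuous_re.comp (cont hg d)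
  have ciG : Continuous fun x => (primitive d g x).im := Complex.continuous_im.comp (cont hg d)
  -- The real and the imaginary part of the product are each a combination of two real products, to
  -- which the real case `E` applies.
  apply Complex.ext
  · have h1 := Complex.reCLM.intervalIntegral_comp_comm hint
    simp only [Complex.reCLM_apply] at h1
    rw [← h1, Complex.sub_re, Complex.mul_re, Complex.mul_re]
    have e1 := E (re_int hfi) (re_int hgi) (hre hf c) (hre hg d)
    have e2 := E (im_int hfi) (im_int hgi) (him hf c) (him hg d)
    have : ∀ x, (f x * primitive d g x + primitive c f x * g x).re =
        ((f x).re * (primitive d g x).re + (primitive c f x).re * (g x).re) -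
        ((f x).im * (primitive d g x).im + (primitive c f x).im * (g x).im) := by
      intro x; simp only [Complex.add_re, Complex.mul_re]; ring
    simp only [this]
    rw [intervalIntegral.integral_sub (I1 (re_int hfi) (re_int hgi) crF crG)
      (I1 (im_int hfi) (im_int hgi) ciF ciG), e1, e2]
    ring
  · have h1 := Complex.imCLM.intervalIntegral_comp_comm hint
    simp only [Complex.imCLM_apply] at h1
    rw [← h1, Complex.sub_im, Complex.mul_im, Complex.mul_im]
    have e1 := E (re_int hfi) (im_int hgi) (hre hf c) (him hg d)
    have e2 := E (im_int hfi) (re_int hgi) (him hf c) (hre hg d)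
    have : ∀ x, (f x * primitive d g x + primitive c f x * g x).im =
        ((f x).re * (primitive d g x).im + (primitive c f x).re * (g x).im) +
        ((f x).im * (primitive d g x).re + (primitive c f x).im * (g x).re) := by
      intro x; simp only [Complex.add_im, Complex.mul_im]; ring
    simp only [this]
    rw [intervalIntegral.integral_add (I1 (re_int hfi) (im_int hgi) crF ciG)
      (I1 (im_int hfi) (re_int hgi) ciF crG), e1, e2]
    ring

/-! ### Test functions and du Bois-Reymond lemmas -/

theorem IsTestFunction.mono {U V : Set ℝ} {φ : ℝ → ℂ} (h : IsTestFunction U φ) (hUV : U ⊆ V) :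
    IsTestFunction V φ :=
  ⟨h.smooth, h.compact_support, h.support_subset.trans hUV⟩

theorem IsTestFunction.deriv {U : Set ℝ} {φ : ℝ → ℂ} (h : IsTestFunction U φ) :
    IsTestFunction U (deriv φ) :=
  ⟨((contDiff_infty_iff_deriv (f := φ)).1 h.smooth).2, h.compact_support.deriv,
    (tsupport_deriv_subset).trans h.support_subset⟩

theorem IsTestFunction.differentiable {U : Set ℝ} {φ : ℝ → ℂ} (h : IsTestFunction U φ) :
    Differentiable ℝ φ := h.smooth.differentiable (by simp)

theorem IsTestFunction.continuous {U : Set ℝ} {φ : ℝ → ℂ} (h : IsTestFunction U φ) :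
    Continuous φ := h.smooth.continuous

theorem IsTestFunction.integrable {U : Set ℝ} {φ : ℝ → ℂ} (h : IsTestFunction U φ) :
    Integrable φ := h.continuous.integrable_of_hasCompactSupport h.compact_support

theorem IsTestFunction.memLp {U : Set ℝ} {φ : ℝ → ℂ} (h : IsTestFunction U φ) :
    MemLp φ 2 volume := h.continuous.memLp_of_hasCompactSupport h.compact_support

theorem IsTestFunction.integrable_mul {U : Set ℝ} {φ f : ℝ → ℂ} (h : IsTestFunction U φ)
    (hf : LocallyIntegrable f) : Integrable (fun x => f x * φ x) := by
  have := hf.integrable_smul_left_of_hasCompactSupport h.continuous h.compact_support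
  simpa [mul_comm] using this

theorem IsTestFunction.sub_const_mul {U : Set ℝ} {φ ψ : ℝ → ℂ} (hφ : IsTestFunction U φ)
    (hψ : IsTestFunction U ψ) (c : ℂ) : IsTestFunction U (fun x => φ x - c * ψ x) := by
  refine ⟨hφ.smooth.sub (contDiff_const.mul hψ.smooth),
    hφ.compact_support.sub (hψ.compact_support.mul_left), ?_⟩
  refine (tsupport_sub φ _).trans (Set.union_subset hφ.support_subset ?_)
  exact (tsupport_mul_subset_right (f := fun _ => c) (g := ψ)).trans hψ.support_subset

theorem exists_forall_eq_zero_of_hasCompactSupport {φ : ℝ → ℂ} (h : HasCompactSupport φ) :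
    ∃ R > 0, ∀ x, R ≤ |x| → φ x = 0 := by
  obtain ⟨R, hR, hs⟩ := h.isBounded.subset_ball_lt 0 0
  refine ⟨R, hR, fun x hx => image_eq_zero_of_notMem_tsupport fun hxs => ?_⟩
  have := hs hxs
  rw [mem_ball_zero_iff, Real.norm_eq_abs] at this
  linarith

theorem integral_eq_intervalIntegral_of_forall {f : ℝ → ℂ} {a b : ℝ} (hab : a ≤ b)
    (h : ∀ x, x ∉ Set.Ioc a b → f x = 0) : ∫ x, f x = ∫ x in a..b, f x := by
  rw [intervalIntegral.integral_of_le hab, setIntegral_eq_integral_of_forall_compl_eq_zero h]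

theorem primitive_deriv {φ : ℝ → ℂ} (h : ContDiff ℝ ∞ φ) : primitive (φ 0) (deriv φ) = φ := by
  ext x
  rw [primitive, intervalIntegral.integral_deriv_eq_sub
    (fun y _ => h.differentiable (by simp) y)
    (((contDiff_infty_iff_deriv (f := φ)).1 h).2.continuous.intervalIntegrable _ _)]
  ring

/-- The weak derivative of a primitive. -/
theorem integral_primitive_mul_deriv (c : ℂ) {f φ : ℝ → ℂ} (hf : LocallyIntegrable f)
    {U : Set ℝ} (hφ : IsTestFunction U φ) :
    ∫ x, primitive c f x * deriv φ x = -∫ x, f x * φ x := by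
  obtain ⟨R, hR, hz⟩ := exists_forall_eq_zero_of_hasCompactSupport hφ.compact_support
  obtain ⟨R', hR', hz'⟩ := exists_forall_eq_zero_of_hasCompactSupport hφ.deriv.compact_support
  have hM : 0 < max R R' := lt_max_of_lt_left hR
  set M := max R R'
  have hout : ∀ x, x ∉ Set.Ioc (-M) M → R ≤ |x| ∧ R' ≤ |x| := by
    intro x hx
    have : M ≤ |x| := by
      by_contra! hlt
      rw [abs_lt] at hlt
      exact hx ⟨hlt.1, hlt.2.le⟩
    exact ⟨(le_max_left _ _).trans this, (le_max_right _ _).trans this⟩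
  have h1 := integral_mul_primitive hf hφ.deriv.continuous.locallyIntegrable c (φ 0) (-M) M
  rw [primitive_deriv hφ.smooth, hz M (by rw [abs_of_pos hM]; exact le_max_left _ _),
    hz (-M) (by rw [abs_neg, abs_of_pos hM]; exact le_max_left _ _), mul_zero, mul_zero,
    sub_zero, intervalIntegral.integral_add] at h1
  · rw [integral_eq_intervalIntegral_of_forall (by linarith : -M ≤ M),
      integral_eq_intervalIntegral_of_forall (by linarith : -M ≤ M)]
    · linear_combination h1
    · intro x hx; rw [hz x (hout x hx).1, mul_zero]
    · intro x hx; rw [hz' x (hout x hx).2, mul_zero]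
  · exact (hf.intervalIntegrable' _ _).mul_continuousOn hφ.continuous.continuousOn
  · exact ((continuous_primitive c hf).mul hφ.deriv.continuous).intervalIntegrable _ _

/-- The antiderivative is started at the least point `m` of the support. It vanishes before `m`, and
past the greatest point `M` because the mean of `ψ` is zero; order-connectedness keeps `[m, M]`
inside `I`. -/
theorem exists_isTestFunction_deriv_eq {I : Set ℝ} (hI : I.OrdConnected) {ψ : ℝ → ℂ}
    (hψ : IsTestFunction I ψ) (h0 : ∫ x, ψ x = 0) :
    ∃ φ, IsTestFunction I φ ∧ deriv φ = ψ := by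
  rcases (tsupport ψ).eq_empty_or_nonempty with he | hne
  · have hz : ψ = 0 := tsupport_eq_empty_iff.1 he
    refine ⟨0, ⟨contDiff_const, HasCompactSupport.zero, ?_⟩, ?_⟩
    · simp [tsupport_eq_empty_iff.2 rfl]
    · rw [hz]; ext x; simp
  obtain ⟨m, hm⟩ := hψ.compact_support.isCompact.exists_isLeast hne
  obtain ⟨M, hM⟩ := hψ.compact_support.isCompact.exists_isGreatest hne
  have hmM : m ≤ M := hm.2 hM.1
  have hz : ∀ x, x ∉ Set.Icc m M → ψ x = 0 := fun x hx =>
    image_eq_zero_of_notMem_tsupport fun h => hx ⟨hm.2 h, hM.2 h⟩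
  set φ : ℝ → ℂ := fun x => ∫ t in m..x, ψ t with hφ
  have hd : ∀ x, HasDerivAt φ (ψ x) x := fun x =>
    intervalIntegral.integral_hasDerivAt_right (hψ.continuous.intervalIntegrable _ _)
      (hψ.continuous.stronglyMeasurableAtFilter _ _) hψ.continuous.continuousAt
  have hdφ : deriv φ = ψ := funext fun x => (hd x).deriv
  have hsupp : ∀ x, x ∉ Set.Icc m M → φ x = 0 := by
    intro x hx
    rcases lt_or_ge x m with h | h
    · refine intervalIntegral.integral_zero_ae ?_
      have : ∀ᵐ t : ℝ, t ≠ m := by simp [ae_iff]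
      filter_upwards [this] with t ht htm
      refine hz t fun h' => ?_
      rw [Set.uIoc_of_ge h.le] at htm
      exact ht (le_antisymm htm.2 h'.1)
    · have hMx : M < x := by by_contra! hc; exact hx ⟨h, hc⟩
      rw [hφ]
      dsimp only
      rw [intervalIntegral.integral_of_le h, ← integral_Icc_eq_integral_Ioc,
        setIntegral_eq_integral_of_forall_compl_eq_zero, h0]
      exact fun t ht => hz t fun h' => ht ⟨h'.1, h'.2.trans hMx.le⟩
  have hts : tsupport φ ⊆ Set.Icc m M :=
    closure_minimal (fun x hx => by by_contra hc; exact hx (hsupp x hc)) isClosed_Icc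
  refine ⟨φ, ⟨?_, ?_, ?_⟩, hdφ⟩
  · rw [contDiff_infty_iff_deriv, hdφ]
    exact ⟨fun x => (hd x).differentiableAt, hψ.smooth⟩
  · exact HasCompactSupport.of_support_subset_isCompact isCompact_Icc
      ((subset_tsupport _).trans hts)
  · exact hts.trans (hI.out (hψ.support_subset hm.1) (hψ.support_subset hM.1))

theorem isTestFunction_ofReal {I : Set ℝ} {ψ : ℝ → ℝ} (h1 : ContDiff ℝ ∞ ψ)
    (h2 : HasCompactSupport ψ) (h3 : tsupport ψ ⊆ I) : IsTestFunction I (fun x => (ψ x : ℂ)) := by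
  refine ⟨Complex.ofRealCLM.contDiff.comp h1, h2.comp_left (g := Complex.ofReal) rfl, ?_⟩
  refine (closure_mono fun x hx => ?_).trans h3
  intro h
  exact hx (by simp [h])

theorem exists_isTestFunction_integral_eq_one {I : Set ℝ} (hI : IsOpen I) {p : ℝ} (hp : p ∈ I) :
    ∃ η, IsTestFunction I η ∧ ∫ x, η x = 1 := by
  obtain ⟨ε, hε, hs⟩ := Metric.isOpen_iff.1 hI p hp
  let b : ContDiffBump p := ⟨ε / 4, ε / 2, by positivity, by linarith⟩
  refine ⟨fun x => ((b.normed volume x : ℝ) : ℂ), isTestFunction_ofReal b.contDiff_normed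
    b.hasCompactSupport_normed ?_, ?_⟩
  · rw [b.tsupport_normed_eq]
    exact (Metric.closedBall_subset_ball (by show ε / 2 < ε; linarith)).trans hs
  · rw [integral_complex_ofReal, b.integral_normed, Complex.ofReal_one]

theorem ae_eq_zero_of_integral_mul_isTestFunction {I : Set ℝ} (hI : IsOpen I) {w : ℝ → ℂ}
    (hw : LocallyIntegrable w) (h : ∀ φ, IsTestFunction I φ → ∫ x, w x * φ x = 0) :
    ∀ᵐ x, x ∈ I → w x = 0 := by
  refine hI.ae_eq_zero_of_integral_contDiff_smul_eq_zero (hw.locallyIntegrableOn I)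
    fun g h1 h2 h3 => ?_
  rw [← h _ (isTestFunction_ofReal h1 h2 h3)]
  exact integral_congr_ae (ae_of_all _ fun x => by simp [mul_comm])

/-- The du Bois-Reymond lemma. -/
theorem ae_eq_const_of_integral_mul_deriv {I : Set ℝ} (hI : IsOpen I) (hc : I.OrdConnected)
    {w : ℝ → ℂ} (hw : LocallyIntegrable w)
    (h : ∀ φ, IsTestFunction I φ → ∫ x, w x * deriv φ x = 0) :
    ∃ c, ∀ᵐ x, x ∈ I → w x = c := by
  rcases I.eq_empty_or_nonempty with rfl | ⟨p, hp⟩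
  · exact ⟨0, by simp⟩
  obtain ⟨η, hη, hη1⟩ := exists_isTestFunction_integral_eq_one hI hp
  -- The function `ψ - (∫ ψ) η` has mean zero, hence is the derivative of a test function; testing
  -- with it gives `∫ w ψ = (∫ w η)(∫ ψ)`.
  refine ⟨∫ x, w x * η x, ?_⟩
  set c := ∫ x, w x * η x
  have := ae_eq_zero_of_integral_mul_isTestFunction hI (w := fun x => w x - c)
    (hw.sub (locallyIntegrable_const c)) fun ψ hψ => ?_
  · filter_upwards [this] with x hx hxI using sub_eq_zero.1 (hx hxI)
  have hψ0 := hψ.sub_const_mul hη (∫ x, ψ x)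
  obtain ⟨φ, hφ, hd⟩ := exists_isTestFunction_deriv_eq hc hψ0 (by
    rw [integral_sub hψ.integrable (hη.integrable.const_mul _), integral_const_mul, hη1]; ring)
  have h2 := h φ hφ
  rw [hd] at h2
  have e1 : ∀ x, w x * (ψ x - (∫ y, ψ y) * η x) = w x * ψ x - (∫ y, ψ y) * (w x * η x) := by
    intro x; ring
  simp only [e1] at h2
  rw [integral_sub (hψ.integrable_mul hw) ((hη.integrable_mul hw).const_mul _),
    integral_const_mul] at h2
  simp only [sub_mul]
  rw [integral_sub (hψ.integrable_mul hw) (hψ.integrable.const_mul _), integral_const_mul]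
  linear_combination h2

/-- The du Bois-Reymond lemma of the second order. -/
theorem ae_eq_affine_of_integral_mul_deriv_deriv {I : Set ℝ} (hI : IsOpen I) (hc : I.OrdConnected)
    {w : ℝ → ℂ} (hw : LocallyIntegrable w)
    (h : ∀ φ, IsTestFunction I φ → ∫ x, w x * deriv (deriv φ) x = 0) :
    ∃ c d : ℂ, ∀ᵐ x, x ∈ I → w x = d + c * x := by
  rcases I.eq_empty_or_nonempty with rfl | ⟨p, hp⟩
  · exact ⟨0, 0, by simp⟩
  obtain ⟨η, hη, hη1⟩ := exists_isTestFunction_integral_eq_one hI hp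
  -- This is minus the slope: the mean-zero correction of `ψ` yields `∫ w ψ' = c ∫ ψ`, so `w + c x`
  -- has zero weak derivative.
  set c := ∫ x, w x * deriv η x with hcdef
  have hlin : LocallyIntegrable (fun x : ℝ => c * (x : ℂ)) :=
    (continuous_const.mul Complex.continuous_ofReal).locallyIntegrable
  obtain ⟨d, hd⟩ := ae_eq_const_of_integral_mul_deriv hI hc (w := fun x => w x + c * x)
    (hw.add hlin) fun ψ hψ => by
      have hψ0 := hψ.sub_const_mul hη (∫ x, ψ x)
      obtain ⟨φ, hφ, hd⟩ := exists_isTestFunction_deriv_eq hc hψ0 (by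
        rw [integral_sub hψ.integrable (hη.integrable.const_mul _), integral_const_mul, hη1]; ring)
      have h2 := h φ hφ
      have hdd : deriv (deriv φ) = fun x => deriv ψ x - (∫ y, ψ y) * deriv η x := by
        rw [hd]; ext x
        exact ((hψ.differentiable x).hasDerivAt.sub
          ((hη.differentiable x).hasDerivAt.const_mul _)).deriv
      rw [hdd] at h2
      have e1 : ∀ x, w x * (deriv ψ x - (∫ y, ψ y) * deriv η x) =
          w x * deriv ψ x - (∫ y, ψ y) * (w x * deriv η x) := by
        intro x; ring
      simp only [e1] at h2
      rw [integral_sub (hψ.deriv.integrable_mul hw) ((hη.deriv.integrable_mul hw).const_mul _),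
        integral_const_mul, ← hcdef] at h2
      have hx := integral_primitive_mul_deriv 0 (locallyIntegrable_const c) hψ
      have hp : ∀ x : ℝ, primitive 0 (fun _ => c) x = c * x := by
        intro x; simp [primitive, mul_comm]
      simp only [hp, integral_const_mul] at hx
      simp only [add_mul]
      rw [integral_add (hψ.deriv.integrable_mul hw) (hψ.deriv.integrable_mul hlin), hx]
      linear_combination h2
  refine ⟨-c, d, ?_⟩
  filter_upwards [hd] with x hx hxI
  linear_combination hx hxI

/-- A function with weak derivative `g` is a primitive of `g`. -/
theorem ae_eq_primitive_of_weakDeriv {I : Set ℝ} (hI : IsOpen I) (hc : I.OrdConnected)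
    {u g : ℝ → ℂ} (hu : LocallyIntegrable u) (hg : LocallyIntegrable g)
    (h : ∀ φ, IsTestFunction I φ → ∫ x, u x * deriv φ x = -∫ x, g x * φ x) :
    ∃ c, ∀ᵐ x, x ∈ I → u x = primitive c g x := by
  have hp := (continuous_primitive 0 hg).locallyIntegrable (μ := volume)
  obtain ⟨c, hc⟩ := ae_eq_const_of_integral_mul_deriv hI hc (hu.sub hp) fun φ hφ => by
    simp only [Pi.sub_apply, sub_mul]
    rw [integral_sub (hφ.deriv.integrable_mul hu) (hφ.deriv.integrable_mul hp), h φ hφ,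
      integral_primitive_mul_deriv 0 hg hφ, sub_self]
  refine ⟨c, ?_⟩
  filter_upwards [hc] with x hx hxI
  have := hx hxI
  simp only [Pi.sub_apply, primitive] at this ⊢
  linear_combination this

/-- Subtracting a double primitive of `f` leaves a function with zero second weak derivative, which
is affine; its two coefficients are absorbed in the constants of integration. -/
theorem ae_eq_primitive_of_weakDeriv_two {I : Set ℝ} (hI : IsOpen I) (hc : I.OrdConnected)
    {u f : ℝ → ℂ} (hu : LocallyIntegrable u) (hf : LocallyIntegrable f)
    (h : ∀ φ, IsTestFunction I φ → ∫ x, u x * deriv (deriv φ) x = ∫ x, f x * φ x) :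
    ∃ c d, ∀ᵐ x, x ∈ I → u x = primitive d (primitive c f) x := by
  have hp1 := (continuous_primitive 0 hf).locallyIntegrable (μ := volume)
  have hp := (continuous_primitive 0 hp1).locallyIntegrable (μ := volume)
  obtain ⟨c, d, hc⟩ := ae_eq_affine_of_integral_mul_deriv_deriv hI hc (hu.sub hp) fun φ hφ => by
    simp only [Pi.sub_apply, sub_mul]
    rw [integral_sub (hφ.deriv.deriv.integrable_mul hu) (hφ.deriv.deriv.integrable_mul hp), h φ hφ,
      integral_primitive_mul_deriv 0 hp1 hφ.deriv, integral_primitive_mul_deriv 0 hf hφ]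
    ring
  refine ⟨c, d, ?_⟩
  filter_upwards [hc] with x hx hxI
  have h1 := hx hxI
  have h2 : primitive d (primitive c f) x = d + c * x + primitive 0 (primitive 0 f) x := by
    have : ∀ t, primitive c f t = c + primitive 0 f t := fun t => by simp [primitive]
    simp only [primitive_eq _ ((continuous_primitive c hf).locallyIntegrable (μ := volume)) 0 x,
      primitive_eq _ hp1 0 x, this]
    rw [intervalIntegral.integral_add (by simp) (hp1.intervalIntegrable' _ _)]
    simp [primitive, mul_comm]
    ring
  rw [h2, ← h1]
  simp

open ComplexConjugate

/-! ### One-sided limits, Wronskians and Green's formula -/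

section Traces

theorem locallyIntegrable_L2 (u : L2R) : LocallyIntegrable u :=
  (Lp.memLp u).locallyIntegrable (by norm_num)

theorem locallyIntegrable_conj {f : ℝ → ℂ} (hf : LocallyIntegrable f) :
    LocallyIntegrable fun x => conj (f x) := fun x => by
  obtain ⟨s, hs, h⟩ := hf x
  refine ⟨s, hs, ?_⟩
  exact (Complex.conjLIE.integrable_comp_iff (φ := f)).2 h

theorem integrable_mul_conj (u w : L2R) : Integrable fun x => u x * conj (w x) := by
  simpa [RCLike.inner_apply] using L2.integrable_inner (𝕜 := ℂ) w u

/-- One-sided intervals have positive measure. This makes essential one-sided limits unique, so that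
`limUnder` computes them. -/
instance neBot_right (x : ℝ) : (𝓝[>] x ⊓ ae (volume : Measure ℝ)).NeBot := by
  refine inf_neBot_iff.2 fun s hs t ht => ?_
  obtain ⟨b, hb, hbs⟩ := (mem_nhdsGT_iff_exists_Ioo_subset).1 hs
  by_contra hne
  have h0 : volume (Set.Ioo x b) = 0 :=
    measure_mono_null (fun y hy hyt => hne ⟨y, hbs hy, hyt⟩) (mem_ae_iff.1 ht)
  simp only [Real.volume_Ioo, ENNReal.ofReal_eq_zero] at h0
  linarith [Set.mem_Ioi.1 hb]

instance neBot_left (x : ℝ) : (𝓝[<] x ⊓ ae (volume : Measure ℝ)).NeBot := by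
  refine inf_neBot_iff.2 fun s hs t ht => ?_
  obtain ⟨b, hb, hbs⟩ := (mem_nhdsLT_iff_exists_Ioo_subset).1 hs
  by_contra hne
  have h0 : volume (Set.Ioo b x) = 0 :=
    measure_mono_null (fun y hy hyt => hne ⟨y, hbs hy, hyt⟩) (mem_ae_iff.1 ht)
  simp only [Real.volume_Ioo, ENNReal.ofReal_eq_zero] at h0
  linarith [Set.mem_Iio.1 hb]

theorem hasRightValue_of_ae {u : L2R} {U : ℝ → ℂ} {a b : ℝ} (hab : a < b) (hU : Continuous U)
    (h : ∀ᵐ x, x ∈ Set.Ioo a b → u x = U x) : HasRightValue u a (U a) := by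
  have h1 : Tendsto U (𝓝[>] a ⊓ ae volume) (𝓝 (U a)) :=
    (hU.tendsto a).mono_left (inf_le_left.trans nhdsWithin_le_nhds)
  refine h1.congr' ?_
  have e1 : ∀ᶠ x in 𝓝[>] a ⊓ ae volume, x ∈ Set.Ioo a b :=
    (inf_le_left : _ ≤ 𝓝[>] a) (Ioo_mem_nhdsGT hab)
  have e2 : ∀ᶠ x in 𝓝[>] a ⊓ ae volume, x ∈ Set.Ioo a b → u x = U x :=
    (inf_le_right : 𝓝[>] a ⊓ ae volume ≤ _) h
  filter_upwards [e1, e2] with x h1 h2 using (h2 h1).symm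

theorem hasLeftValue_of_ae {u : L2R} {U : ℝ → ℂ} {a b : ℝ} (hab : a < b) (hU : Continuous U)
    (h : ∀ᵐ x, x ∈ Set.Ioo a b → u x = U x) : HasLeftValue u b (U b) := by
  have h1 : Tendsto U (𝓝[<] b ⊓ ae volume) (𝓝 (U b)) :=
    (hU.tendsto b).mono_left (inf_le_left.trans nhdsWithin_le_nhds)
  refine h1.congr' ?_
  have e1 : ∀ᶠ x in 𝓝[<] b ⊓ ae volume, x ∈ Set.Ioo a b :=
    (inf_le_left : _ ≤ 𝓝[<] b) (Ioo_mem_nhdsLT hab)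
  have e2 : ∀ᶠ x in 𝓝[<] b ⊓ ae volume, x ∈ Set.Ioo a b → u x = U x :=
    (inf_le_right : 𝓝[<] b ⊓ ae volume ≤ _) h
  filter_upwards [e1, e2] with x h1 h2 using (h2 h1).symm

/-- The value `u(x + 0)`. -/
noncomputable def rightValue (u : L2R) (x : ℝ) : ℂ := limUnder (𝓝[>] x ⊓ ae volume) u

/-- The value `u(x - 0)`. -/
noncomputable def leftValue (u : L2R) (x : ℝ) : ℂ := limUnder (𝓝[<] x ⊓ ae volume) u

theorem HasRightValue.eq {u : L2R} {x : ℝ} {c : ℂ} (h : HasRightValue u x c) :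
    rightValue u x = c := Tendsto.limUnder_eq h

theorem HasLeftValue.eq {u : L2R} {x : ℝ} {c : ℂ} (h : HasLeftValue u x c) :
    leftValue u x = c := Tendsto.limUnder_eq h

theorem exists_pos_forall_abs_lt {X : Set ℝ} (hX : X.Finite) (a : ℝ) :
    ∃ ε > 0, ∀ y ∈ X, |y - a| < ε → y = a := by
  have : (X \ {a})ᶜ ∈ 𝓝 a := (hX.sdiff).isClosed.isOpen_compl.mem_nhds (by simp)
  obtain ⟨ε, hε, h⟩ := Metric.mem_nhds_iff.1 this
  refine ⟨ε, hε, fun y hy hya => ?_⟩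
  by_contra hne
  exact h (show y ∈ Metric.ball a ε from hya) ⟨hy, hne⟩

theorem exists_Ioo_right_subset {X : Set ℝ} (hX : X.Finite) (a : ℝ) :
    ∃ b, a < b ∧ Set.Ioo a b ⊆ Xᶜ := by
  obtain ⟨ε, hε, h⟩ := exists_pos_forall_abs_lt hX a
  refine ⟨a + ε, by linarith, fun y hy hyX => ?_⟩
  have := h y hyX (by rw [abs_lt]; constructor <;> linarith [hy.1, hy.2])
  exact hy.1.ne' this

theorem exists_Ioo_left_subset {X : Set ℝ} (hX : X.Finite) (b : ℝ) :
    ∃ a, a < b ∧ Set.Ioo a b ⊆ Xᶜ := by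
  obtain ⟨ε, hε, h⟩ := exists_pos_forall_abs_lt hX b
  refine ⟨b - ε, by linarith, fun y hy hyX => ?_⟩
  have := h y hyX (by rw [abs_lt]; constructor <;> linarith [hy.1, hy.2])
  exact hy.2.ne this

variable {X : Set ℝ} {u g f w k l : L2R}

theorem IsWeakDeriv.exists_ae_eq (h : IsWeakDeriv X u g) {I : Set ℝ} (hI : IsOpen I)
    (hc : I.OrdConnected) (hIX : I ⊆ Xᶜ) : ∃ c, ∀ᵐ x, x ∈ I → u x = primitive c g x :=
  ae_eq_primitive_of_weakDeriv hI hc (locallyIntegrable_L2 u) (locallyIntegrable_L2 g)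
    fun φ hφ => h φ (hφ.mono hIX)

theorem IsWeakDeriv.hasRightValue (hX : X.Finite) (h : IsWeakDeriv X u g) (x : ℝ) :
    HasRightValue u x (rightValue u x) := by
  obtain ⟨b, hb, hs⟩ := exists_Ioo_right_subset hX x
  obtain ⟨c, hc⟩ := h.exists_ae_eq isOpen_Ioo Set.ordConnected_Ioo hs
  have := hasRightValue_of_ae hb (continuous_primitive c (locallyIntegrable_L2 g)) hc
  rwa [this.eq]

theorem IsWeakDeriv.hasLeftValue (hX : X.Finite) (h : IsWeakDeriv X u g) (x : ℝ) :
    HasLeftValue u x (leftValue u x) := by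
  obtain ⟨b, hb, hs⟩ := exists_Ioo_left_subset hX x
  obtain ⟨c, hc⟩ := h.exists_ae_eq isOpen_Ioo Set.ordConnected_Ioo hs
  have := hasLeftValue_of_ae hb (continuous_primitive c (locallyIntegrable_L2 g)) hc
  rwa [this.eq]

theorem IsWeakDeriv.rightValue_eq_leftValue (hX : X.Finite) (h : IsWeakDeriv X u g) {x : ℝ}
    (hx : x ∉ X) : rightValue u x = leftValue u x := by
  obtain ⟨a, ha, hsa⟩ := exists_Ioo_left_subset hX x
  obtain ⟨b, hb, hsb⟩ := exists_Ioo_right_subset hX x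
  have hs : Set.Ioo a b ⊆ Xᶜ := by
    intro y hy
    rcases lt_trichotomy y x with hyx | rfl | hyx
    · exact hsa ⟨hy.1, hyx⟩
    · exact hx
    · exact hsb ⟨hyx, hy.2⟩
  obtain ⟨c, hc⟩ := h.exists_ae_eq isOpen_Ioo Set.ordConnected_Ioo hs
  have hcont := continuous_primitive c (locallyIntegrable_L2 g)
  rw [(hasRightValue_of_ae hb hcont (hc.mono fun y hy hyx => hy ⟨ha.trans hyx.1, hyx.2⟩)).eq,
    (hasLeftValue_of_ae ha hcont (hc.mono fun y hy hyx => hy ⟨hyx.1, hyx.2.trans hb⟩)).eq]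

/-- Weak derivatives of functions that agree on an open set agree there. -/
theorem IsWeakDeriv.ae_eq (hX : X.Finite) (h1 : IsWeakDeriv X u g) (h2 : IsWeakDeriv X w k)
    {I : Set ℝ} (hI : IsOpen I) (h : ∀ᵐ x, x ∈ I → u x = w x) : ∀ᵐ x, x ∈ I → g x = k x := by
  have hz := ae_eq_zero_of_integral_mul_isTestFunction (hI.inter hX.isClosed.isOpen_compl)
    (w := fun x => g x - k x) ((locallyIntegrable_L2 g).sub (locallyIntegrable_L2 k))
    fun φ hφ => by
      have e1 := h1 φ (hφ.mono Set.inter_subset_right)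
      have e2 := h2 φ (hφ.mono Set.inter_subset_right)
      simp only [sub_mul]
      rw [integral_sub (hφ.integrable_mul (locallyIntegrable_L2 g))
        (hφ.integrable_mul (locallyIntegrable_L2 k))]
      have : ∫ x, u x * deriv φ x = ∫ x, w x * deriv φ x := by
        refine integral_congr_ae ?_
        filter_upwards [h] with x hx
        by_cases hxI : x ∈ I
        · rw [hx hxI]
        · rw [image_eq_zero_of_notMem_tsupport (f := deriv φ)
            fun hc => hxI (hφ.deriv.support_subset hc).1, mul_zero, mul_zero]
      linear_combination e1 - e2 - this
  have hX0 : ∀ᵐ x : ℝ, x ∉ X := hX.countable.ae_notMem _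
  filter_upwards [hz, hX0] with x hx hxX hxI using sub_eq_zero.1 (hx ⟨hxI, hxX⟩)

/-- The right limit of the Wronskian of `u` and the conjugate of `w`, with derivatives `g`, `k`. -/
noncomputable def wronskianRight (u g w k : L2R) (x : ℝ) : ℂ :=
  rightValue g x * conj (rightValue w x) - rightValue u x * conj (rightValue k x)

/-- The left limit of the Wronskian of `u` and the conjugate of `w`, with derivatives `g`, `k`. -/
noncomputable def wronskianLeft (u g w k : L2R) (x : ℝ) : ℂ :=
  leftValue g x * conj (leftValue w x) - leftValue u x * conj (leftValue k x)

theorem conj_primitive (c : ℂ) (f : ℝ → ℂ) (x : ℝ) :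
    conj (primitive c f x) = primitive (conj c) (fun t => conj (f t)) x := by
  simp only [primitive, map_add]
  congr 1
  simp only [intervalIntegral, map_sub, integral_conj]

/-- Off `X` all four functions are primitives, and differentiating the Wronskian cancels the two `g
k̄` terms. The primitives are continuous on all of `ℝ`, so `H` also gives the one-sided limits at
endpoints of `I` that belong to `X`. -/
theorem exists_wronskian (h1 : IsW22 X u g f) (h2 : IsW22 X w k l) {I : Set ℝ} (hI : IsOpen I)
    (hc : I.OrdConnected) (hIX : I ⊆ Xᶜ) : ∃ H : ℝ → ℂ,
      (∀ᵐ x, x ∈ I → g x * conj (w x) - u x * conj (k x) = H x) ∧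
      (∀ a b, a < b → Set.Ioo a b ⊆ I →
        ∫ x in a..b, (f x * conj (w x) - u x * conj (l x)) = H b - H a) ∧
      (∀ a b, a < b → Set.Ioo a b ⊆ I → wronskianRight u g w k a = H a) ∧
      (∀ a b, a < b → Set.Ioo a b ⊆ I → wronskianLeft u g w k b = H b) := by
  obtain ⟨cu, hu⟩ := h1.weak_deriv.exists_ae_eq hI hc hIX
  obtain ⟨cg, hg⟩ := h1.weak_deriv_two.exists_ae_eq hI hc hIX
  obtain ⟨cw, hw⟩ := h2.weak_deriv.exists_ae_eq hI hc hIX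
  obtain ⟨ck, hk⟩ := h2.weak_deriv_two.exists_ae_eq hI hc hIX
  have Lg := locallyIntegrable_L2 g
  have Lf := locallyIntegrable_L2 f
  have Lk := locallyIntegrable_L2 k
  have Ll := locallyIntegrable_L2 l
  have Cu := continuous_primitive cu Lg
  have Cg := continuous_primitive cg Lf
  have Cw := continuous_primitive cw Lk
  have Ck := continuous_primitive ck Ll
  refine ⟨fun x => primitive cg f x * conj (primitive cw k x) -
    primitive cu g x * conj (primitive ck l x), ?_, ?_, ?_, ?_⟩
  · filter_upwards [hu, hg, hw, hk] with x h1 h2 h3 h4 hx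
    rw [h1 hx, h2 hx, h3 hx, h4 hx]
  · intro a b hab hs
    have e1 := integral_mul_primitive Lf (locallyIntegrable_conj Lk) cg (conj cw) a b
    have e2 := integral_mul_primitive Lg (locallyIntegrable_conj Ll) cu (conj ck) a b
    simp only [← conj_primitive] at e1 e2
    have i1 : IntervalIntegrable (fun x => f x * conj (primitive cw k x) +
        primitive cg f x * conj (k x)) volume a b :=
      ((Lf.intervalIntegrable' a b).mul_continuousOn
        (Complex.continuous_conj.comp Cw).continuousOn).add
      (((locallyIntegrable_conj Lk).intervalIntegrable' a b).continuousOn_mul Cg.continuousOn)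
    have i2 : IntervalIntegrable (fun x => g x * conj (primitive ck l x) +
        primitive cu g x * conj (l x)) volume a b :=
      ((Lg.intervalIntegrable' a b).mul_continuousOn
        (Complex.continuous_conj.comp Ck).continuousOn).add
      (((locallyIntegrable_conj Ll).intervalIntegrable' a b).continuousOn_mul Cu.continuousOn)
    have e3 := intervalIntegral.integral_sub i1 i2
    rw [e1, e2] at e3
    have e4 : ∫ x in a..b, (f x * conj (w x) - u x * conj (l x)) =
        ∫ x in a..b, ((f x * conj (primitive cw k x) + primitive cg f x * conj (k x)) -
          (g x * conj (primitive ck l x) + primitive cu g x * conj (l x))) := by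
      refine intervalIntegral.integral_congr_ae ?_
      have hb : ∀ᵐ x : ℝ, x ≠ b := by simp [ae_iff]
      filter_upwards [hu, hg, hw, hk, hb] with x h1 h2 h3 h4 hxb hx
      rw [Set.uIoc_of_le hab.le] at hx
      have hxI := hs ⟨hx.1, lt_of_le_of_ne hx.2 hxb⟩
      rw [← h1 hxI, ← h2 hxI, ← h3 hxI, ← h4 hxI]
      ring
    rw [e4, e3]
    ring
  · intro a b hab hs
    have key : ∀ {v : L2R} {V : ℝ → ℂ}, Continuous V → (∀ᵐ x, x ∈ I → v x = V x) →
        rightValue v a = V a := fun hV hv =>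
      (hasRightValue_of_ae hab hV (hv.mono fun x hx hxs => hx (hs hxs))).eq
    rw [wronskianRight, key Cu hu, key Cg hg, key Cw hw, key Ck hk]
  · intro a b hab hs
    have key : ∀ {v : L2R} {V : ℝ → ℂ}, Continuous V → (∀ᵐ x, x ∈ I → v x = V x) →
        leftValue v b = V b := fun hV hv =>
      (hasLeftValue_of_ae hab hV (hv.mono fun x hx hxs => hx (hs hxs))).eq
    rw [wronskianLeft, key Cu hu, key Cg hg, key Cw hw, key Ck hk]

theorem integrable_greenIntegrand (u f w l : L2R) :
    Integrable fun x => f x * conj (w x) - u x * conj (l x) :=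
  (integrable_mul_conj f w).sub (integrable_mul_conj u l)

/-- There is no contribution from infinity: `H` converges there because the Green integrand is
integrable, and the limit is zero because `H` is itself integrable near infinity. -/
theorem integral_Ioi_of_subset_compl (h1 : IsW22 X u g f) (h2 : IsW22 X w k l) {a : ℝ}
    (ha : Set.Ioi a ⊆ Xᶜ) :
    ∫ x in Set.Ioi a, (f x * conj (w x) - u x * conj (l x)) = -wronskianRight u g w k a := by
  obtain ⟨H, hH, hint, hr, -⟩ := exists_wronskian h1 h2 isOpen_Ioi Set.ordConnected_Ioi ha
  have hK := integrable_greenIntegrand u f w l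
  have t1 : Tendsto (fun b => ∫ x in a..b, (f x * conj (w x) - u x * conj (l x))) atTop
      (𝓝 (∫ x in Set.Ioi a, (f x * conj (w x) - u x * conj (l x)))) :=
    intervalIntegral_tendsto_integral_Ioi a hK.integrableOn tendsto_id
  have t2 : Tendsto H atTop
      (𝓝 ((∫ x in Set.Ioi a, (f x * conj (w x) - u x * conj (l x))) + H a)) := by
    refine (t1.add_const (H a)).congr' ?_
    filter_upwards [eventually_gt_atTop a] with b hb
    rw [hint a b hb fun x hx => hx.1]
    ring
  have hz : IntegrableAtFilter H atTop := by
    refine ⟨Set.Ioi a, Ioi_mem_atTop a, ?_⟩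
    refine ((integrable_mul_conj g w).sub (integrable_mul_conj u k)).integrableOn.congr ?_
    rw [EventuallyEq, ae_restrict_iff' measurableSet_Ioi]
    exact hH
  have h0 := hz.eq_zero_of_tendsto (fun s hs => by
    obtain ⟨b, hb⟩ := mem_atTop_sets.1 hs
    rw [← top_le_iff, ← Real.volume_Ici (a := b)]
    exact measure_mono hb) t2
  rw [hr a (a + 1) (by linarith) fun x hx => hx.1]
  linear_combination h0

theorem integral_Iio_of_subset_compl (h1 : IsW22 X u g f) (h2 : IsW22 X w k l) {b : ℝ}
    (hb : Set.Iio b ⊆ Xᶜ) :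
    ∫ x in Set.Iio b, (f x * conj (w x) - u x * conj (l x)) = wronskianLeft u g w k b := by
  obtain ⟨H, hH, hint, -, hl⟩ := exists_wronskian h1 h2 isOpen_Iio Set.ordConnected_Iio hb
  have hK := integrable_greenIntegrand u f w l
  have t1 : Tendsto (fun a => ∫ x in a..b, (f x * conj (w x) - u x * conj (l x))) atBot
      (𝓝 (∫ x in Set.Iic b, (f x * conj (w x) - u x * conj (l x)))) :=
    intervalIntegral_tendsto_integral_Iic b hK.integrableOn tendsto_id
  rw [integral_Iic_eq_integral_Iio] at t1
  have t2 : Tendsto H atBot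
      (𝓝 (H b - (∫ x in Set.Iio b, (f x * conj (w x) - u x * conj (l x))))) := by
    refine (t1.const_sub (H b)).congr' ?_
    filter_upwards [eventually_lt_atBot b] with a ha
    rw [hint a b ha fun x hx => hx.2]
    ring
  have hz : IntegrableAtFilter H atBot := by
    refine ⟨Set.Iio b, Iio_mem_atBot b, ?_⟩
    refine ((integrable_mul_conj g w).sub (integrable_mul_conj u k)).integrableOn.congr ?_
    rw [EventuallyEq, ae_restrict_iff' measurableSet_Iio]
    exact hH
  have h0 := hz.eq_zero_of_tendsto (fun s hs => by
    obtain ⟨a, ha⟩ := mem_atBot_sets.1 hs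
    rw [← top_le_iff, ← Real.volume_Iic (a := a)]
    exact measure_mono ha) t2
  rw [hl (b - 1) b (by linarith) fun x hx => hx.2]
  linear_combination -h0

/-- Induction on the number of points of `X` beyond `a`: the one nearest to `a` is split off, and
the absence of a jump there makes the boundary terms cancel. -/
theorem integral_Ioi_eq_neg_wronskianRight (hX : X.Finite) (h1 : IsW22 X u g f)
    (h2 : IsW22 X w k l) (a : ℝ)
    (hJ : ∀ x ∈ X, a < x → wronskianRight u g w k x = wronskianLeft u g w k x) :
    ∫ x in Set.Ioi a, (f x * conj (w x) - u x * conj (l x)) = -wronskianRight u g w k a := by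
  induction hn : (X ∩ Set.Ioi a).ncard using Nat.strong_induction_on generalizing a with
  | _ n ih =>
    rcases (X ∩ Set.Ioi a).eq_empty_or_nonempty with he | hne
    · exact integral_Ioi_of_subset_compl h1 h2 fun x hx hxX =>
        Set.eq_empty_iff_forall_notMem.1 he x ⟨hxX, hx⟩
    · have hfin : (X ∩ Set.Ioi a).Finite := hX.inter_of_left _
      obtain ⟨x, ⟨hxX, hax⟩, hmin⟩ := Set.exists_min_image _ id hfin hne
      have hlt : (X ∩ Set.Ioi x).ncard < n := by
        rw [← hn]
        refine Set.ncard_lt_ncard ⟨fun y hy => ⟨hy.1, Set.mem_Ioi.2 (lt_trans hax hy.2)⟩, fun hc => ?_⟩ hfin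
        exact lt_irrefl x (hc ⟨hxX, hax⟩).2
      have hx := ih _ hlt x (fun y hy hxy => hJ y hy (lt_trans hax hxy)) rfl
      have hs : Set.Ioo a x ⊆ Xᶜ := fun y hy hyX =>
        absurd (hmin y ⟨hyX, hy.1⟩) (not_le.2 hy.2)
      obtain ⟨H, -, hint, hr, hl⟩ := exists_wronskian h1 h2 isOpen_Ioo Set.ordConnected_Ioo hs
      have hK := integrable_greenIntegrand u f w l
      rw [← intervalIntegral.integral_interval_add_Ioi hK.integrableOn hK.integrableOn, hx,
        hint a x hax le_rfl, hJ x hxX hax, hr a x hax le_rfl, hl a x hax le_rfl]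
      ring

theorem integral_Iio_eq_wronskianLeft (hX : X.Finite) (h1 : IsW22 X u g f)
    (h2 : IsW22 X w k l) (b : ℝ)
    (hJ : ∀ x ∈ X, x < b → wronskianRight u g w k x = wronskianLeft u g w k x) :
    ∫ x in Set.Iio b, (f x * conj (w x) - u x * conj (l x)) = wronskianLeft u g w k b := by
  induction hn : (X ∩ Set.Iio b).ncard using Nat.strong_induction_on generalizing b with
  | _ n ih =>
    rcases (X ∩ Set.Iio b).eq_empty_or_nonempty with he | hne
    · exact integral_Iio_of_subset_compl h1 h2 fun x hx hxX =>
        Set.eq_empty_iff_forall_notMem.1 he x ⟨hxX, hx⟩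
    · have hfin : (X ∩ Set.Iio b).Finite := hX.inter_of_left _
      obtain ⟨x, ⟨hxX, hxb⟩, hmax⟩ := Set.exists_max_image _ id hfin hne
      have hlt : (X ∩ Set.Iio x).ncard < n := by
        rw [← hn]
        refine Set.ncard_lt_ncard ⟨fun y hy => ⟨hy.1, Set.mem_Iio.2 (lt_trans hy.2 hxb)⟩, fun hc => ?_⟩ hfin
        exact lt_irrefl x (hc ⟨hxX, hxb⟩).2
      have hx := ih _ hlt x (fun y hy hxy => hJ y hy (lt_trans hxy hxb)) rfl
      have hs : Set.Ioo x b ⊆ Xᶜ := fun y hy hyX =>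
        absurd (hmax y ⟨hyX, hy.2⟩) (not_le.2 hy.1)
      obtain ⟨H, -, hint, hr, hl⟩ := exists_wronskian h1 h2 isOpen_Ioo Set.ordConnected_Ioo hs
      have hK := integrable_greenIntegrand u f w l
      have hsub := intervalIntegral.integral_Iic_sub_Iic (hK.integrableOn (s := Set.Iic x))
        (hK.integrableOn (s := Set.Iic b))
      rw [integral_Iic_eq_integral_Iio, integral_Iic_eq_integral_Iio, hx,
        hint x b hxb le_rfl, ← hJ x hxX hxb, hr x b hxb le_rfl] at hsub
      rw [hl x b hxb le_rfl]
      linear_combination hsub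

/-- Green's formula, for functions whose Wronskian is continuous except at one point. -/
theorem green_formula (hX : X.Finite) (h1 : IsW22 X u g f) (h2 : IsW22 X w k l) (x₀ : ℝ)
    (hJ : ∀ x ∈ X, x ≠ x₀ → wronskianRight u g w k x = wronskianLeft u g w k x) :
    ∫ x, (f x * conj (w x) - u x * conj (l x)) =
      wronskianLeft u g w k x₀ - wronskianRight u g w k x₀ := by
  have hK := integrable_greenIntegrand u f w l
  rw [← intervalIntegral.integral_Iic_add_Ioi (b := x₀) hK.integrableOn hK.integrableOn,
    integral_Iic_eq_integral_Iio,
    integral_Iio_eq_wronskianLeft hX h1 h2 x₀ fun x hx hlt => hJ x hx hlt.ne,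
    integral_Ioi_eq_neg_wronskianRight hX h1 h2 x₀ fun x hx hlt => hJ x hx hlt.ne']
  ring

theorem green_formula_zero (hX : X.Finite) (h1 : IsW22 X u g f) (h2 : IsW22 X w k l)
    (hJ : ∀ x ∈ X, wronskianRight u g w k x = wronskianLeft u g w k x) :
    ∫ x, (f x * conj (w x) - u x * conj (l x)) = 0 := by
  -- The splitting point `0` is arbitrary: the Wronskian has no jump there, whether or not it
  -- belongs to `X`.
  rw [green_formula hX h1 h2 0 fun x hx _ => hJ x hx, sub_eq_zero]
  by_cases h0 : (0 : ℝ) ∈ X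
  · exact (hJ 0 h0).symm
  · rw [wronskianLeft, wronskianRight, h1.weak_deriv.rightValue_eq_leftValue hX h0,
      h1.weak_deriv_two.rightValue_eq_leftValue hX h0,
      h2.weak_deriv.rightValue_eq_leftValue hX h0,
      h2.weak_deriv_two.rightValue_eq_leftValue hX h0]

end Traces

/-! ### Square integrability of the first derivative -/

/-- Overlapping local representations therefore share their constants, which is what allows them to
be glued. -/
theorem eq_of_primitive_primitive_ae_eq {f : ℝ → ℂ} (hf : LocallyIntegrable f) {c d c' d' : ℂ}
    {a b : ℝ} (hab : a < b) (h : ∀ᵐ x, x ∈ Set.Ioo a b →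
      primitive d (primitive c f) x = primitive d' (primitive c' f) x) : c = c' ∧ d = d' := by
  have C1 : ∀ e, Continuous (primitive e f) := fun e => continuous_primitive e hf
  have C2 : ∀ e e', Continuous (primitive e' (primitive e f)) := fun e e' =>
    continuous_primitive e' (C1 e).locallyIntegrable
  have heq : Set.EqOn (primitive d (primitive c f)) (primitive d' (primitive c' f))
      (Set.Ioo a b) := by
    refine Measure.eqOn_open_of_ae_eq (μ := volume) ?_ isOpen_Ioo (C2 _ _).continuousOn
      (C2 _ _).continuousOn
    rw [EventuallyEq, ae_restrict_iff' measurableSet_Ioo]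
    exact h
  have hm : (a + b) / 2 ∈ Set.Ioo a b := ⟨by linarith, by linarith⟩
  have hd := (hasDerivAt_primitive d (C1 c) ((a + b) / 2)).congr_of_eventuallyEq
    (heq.symm.eventuallyEq_of_mem (Ioo_mem_nhds hm.1 hm.2))
  have hcc := hd.unique (hasDerivAt_primitive d' (C1 c') ((a + b) / 2))
  have hc : c = c' := by simpa [primitive] using hcc
  subst hc
  exact ⟨rfl, by simpa [primitive] using heq hm⟩

theorem locallyIntegrable_norm {f : ℝ → ℂ} (hf : LocallyIntegrable f) :
    LocallyIntegrable fun x => ‖f x‖ := fun x => by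
  obtain ⟨s, hs, h⟩ := hf x
  exact ⟨s, hs, h.norm⟩

/-- By Cauchy-Schwarz the square is at most twice the integral of `‖f‖²` over the window, which is
the convolution of an integrable function with an indicator. -/
theorem memLp_intervalIntegral_norm (f : L2R) :
    MemLp (fun x => ∫ t in (x - 1)..(x + 1), ‖f t‖) 2 volume := by
  have Lf := locallyIntegrable_norm (locallyIntegrable_L2 f)
  have hf2 : Integrable (fun x => ‖f x‖ ^ 2) := (Lp.memLp f).integrable_norm_pow (by norm_num)
  have Ii : ∀ a b, IntervalIntegrable (fun x => ‖f x‖) volume a b := fun a b =>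
    (Lf.integrableOn_isCompact isCompact_uIcc).intervalIntegrable
  have hcont : Continuous fun x : ℝ => ∫ t in (x - 1)..(x + 1), ‖f t‖ := by
    have h1 := intervalIntegral.continuous_primitive Ii 0
    have : (fun x : ℝ => ∫ t in (x - 1)..(x + 1), ‖f t‖) =
        fun x => (∫ t in (0 : ℝ)..(x + 1), ‖f t‖) - ∫ t in (0 : ℝ)..(x - 1), ‖f t‖ := by
      ext x
      rw [intervalIntegral.integral_interval_sub_left (Ii _ _) (Ii _ _)]
    rw [this]
    exact (h1.comp (continuous_id.add continuous_const)).sub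
      (h1.comp (continuous_id.sub continuous_const))
  have hP : Integrable fun x : ℝ => ∫ t in (x - 1)..(x + 1), ‖f t‖ ^ 2 := by
    have hind : Integrable (Set.indicator (Set.Ico (-1 : ℝ) 1) fun _ => (1 : ℝ)) :=
      (integrable_indicator_iff measurableSet_Ico).2 (by simp)
    have := hf2.integrable_convolution (ContinuousLinearMap.mul ℝ ℝ) hind
    refine this.congr (ae_of_all _ fun x => ?_)
    simp only [convolution, ContinuousLinearMap.mul_apply']
    rw [intervalIntegral.integral_of_le (by linarith), ← integral_indicator measurableSet_Ioc]
    refine integral_congr_ae (ae_of_all _ fun t => ?_)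
    simp only [Set.indicator]
    have : x - t ∈ Set.Ico (-1 : ℝ) 1 ↔ t ∈ Set.Ioc (x - 1) (x + 1) := by
      simp only [Set.mem_Ico, Set.mem_Ioc]; constructor <;> rintro ⟨h1, h2⟩ <;>
        constructor <;> linarith
    simp only [this]
    split_ifs <;> simp
  rw [memLp_two_iff_integrable_sq hcont.aestronglyMeasurable]
  refine (hP.const_mul 2).mono' (hcont.pow 2).aestronglyMeasurable (ae_of_all _ fun x => ?_)
  set F := ∫ t in (x - 1)..(x + 1), ‖f t‖
  have i2 : IntervalIntegrable (fun t => ‖f t‖ ^ 2) volume (x - 1) (x + 1) :=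
    hf2.intervalIntegrable
  -- Cauchy-Schwarz by expanding a variance: `F / 2` is the mean of `‖f‖` over a window of length
  -- `2`.
  have hnn : 0 ≤ ∫ t in (x - 1)..(x + 1), (‖f t‖ - F / 2) ^ 2 :=
    intervalIntegral.integral_nonneg (by linarith) fun t _ => sq_nonneg _
  have e : ∀ t, (‖f t‖ - F / 2) ^ 2 = (‖f t‖ ^ 2 - F * ‖f t‖) + F ^ 2 / 4 := fun t => by ring
  simp only [e] at hnn
  rw [intervalIntegral.integral_add (i2.sub ((Ii _ _).const_mul _)) (by simp),
    intervalIntegral.integral_sub i2 ((Ii _ _).const_mul _),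
    intervalIntegral.integral_const_mul, intervalIntegral.integral_const] at hnn
  rw [Real.norm_eq_abs, abs_of_nonneg (sq_nonneg _)]
  simp only [smul_eq_mul] at hnn
  have : (x + 1 - (x - 1)) * (F ^ 2 / 4) = F ^ 2 / 2 := by ring
  rw [this] at hnn
  nlinarith

/-- A primitive of `f` is controlled by the increments of its primitive and by `f`. -/
theorem norm_primitive_le {f : ℝ → ℂ} (hf : LocallyIntegrable f) (c d : ℂ) {s : ℝ}
    (hs : |s| = 1) (x : ℝ) :
    ‖primitive c f x‖ ≤ ‖primitive d (primitive c f) (x + s)‖ + ‖primitive d (primitive c f) x‖ +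
      ∫ t in (x - 1)..(x + 1), ‖f t‖ := by
  have C1 := continuous_primitive c hf
  set G := primitive c f
  have Ii : ∀ a b, IntervalIntegrable (fun x => ‖f x‖) volume a b := fun a b =>
    ((locallyIntegrable_norm hf).integrableOn_isCompact isCompact_uIcc).intervalIntegrable
  have hs' := abs_le.1 hs.le
  have h1 : primitive d G (x + s) - primitive d G x = ∫ t in x..(x + s), G t :=
    primitive_sub d C1.locallyIntegrable _ _
  -- Integrating `G t - G x` over a step of length one isolates `s * G x`, whose norm is `‖G x‖`;
  -- the deviation `G t - G x` is an integral of `f` within the window.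
  have h2 : ∫ t in x..(x + s), (G t - G x) =
      primitive d G (x + s) - primitive d G x - s * G x := by
    rw [intervalIntegral.integral_sub (C1.intervalIntegrable _ _) (by simp), h1,
      intervalIntegral.integral_const]
    simp
  have h3 : ‖∫ t in x..(x + s), (G t - G x)‖ ≤
      (∫ t in (x - 1)..(x + 1), ‖f t‖) * |x + s - x| := by
    refine intervalIntegral.norm_integral_le_of_norm_le_const fun t ht => ?_
    rw [primitive_sub c hf x t]
    have hsub : Set.uIoc x t ⊆ Set.Ioc (x - 1) (x + 1) := by
      intro y hy
      have h5 := Set.uIoc_subset_uIcc ht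
      rw [Set.mem_uIoc] at ht hy
      constructor
      · rcases hy with h | h <;> rcases ht with h' | h' <;> linarith [h.1, h.2, h'.1, h'.2]
      · rcases hy with h | h <;> rcases ht with h' | h' <;> linarith [h.1, h.2, h'.1, h'.2]
    refine (intervalIntegral.norm_integral_le_integral_norm_uIoc).trans ?_
    rw [intervalIntegral.integral_of_le (by linarith : x - 1 ≤ x + 1)]
    refine setIntegral_mono_set ?_ (ae_of_all _ fun y => norm_nonneg _) hsub.eventuallyLE
    exact (Ii (x - 1) (x + 1)).1
  rw [add_sub_cancel_left, hs, mul_one, h2] at h3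
  have h4 : ‖G x‖ = ‖(s : ℂ) * G x‖ := by
    rw [norm_mul, Complex.norm_real, Real.norm_eq_abs, hs, one_mul]
  calc ‖G x‖ = ‖(primitive d G (x + s) - primitive d G x) -
        (primitive d G (x + s) - primitive d G x - s * G x)‖ := by rw [h4]; congr 1; ring
    _ ≤ ‖primitive d G (x + s) - primitive d G x‖ +
        ‖primitive d G (x + s) - primitive d G x - s * G x‖ := norm_sub_le _ _
    _ ≤ _ := add_le_add (norm_sub_le _ _) h3

/-- Meant for half-lines, with `s = 1` on the right and `s = -1` on the left: the bound of
`norm_primitive_le` involves only `u`, its translate and a window average of `‖f‖`. -/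
theorem memLp_primitive_of_ae_eq {u f : L2R} {S : Set ℝ} (hS : MeasurableSet S) {s : ℝ}
    (hs : |s| = 1) (hSs : ∀ x ∈ S, x + s ∈ S) {c d : ℂ}
    (h : ∀ᵐ x, x ∈ S → u x = primitive d (primitive c f) x) :
    MemLp (primitive c f) 2 (volume.restrict S) := by
  have hf := locallyIntegrable_L2 f
  have hmp := measurePreserving_add_right (volume : Measure ℝ) s
  have hu : MemLp (fun x => ‖u (x + s)‖ + ‖u x‖ + ∫ t in (x - 1)..(x + 1), ‖f t‖) 2
      (volume.restrict S) :=
    ((((Lp.memLp u).comp_measurePreserving hmp).norm.add (Lp.memLp u).norm).add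
      (memLp_intervalIntegral_norm f)).restrict S
  refine hu.mono' (continuous_primitive c hf).aestronglyMeasurable ?_
  rw [ae_restrict_iff' hS]
  filter_upwards [h, hmp.quasiMeasurePreserving.ae h] with x h1 h2 hx
  rw [h1 hx, h2 (hSs x hx)]
  exact norm_primitive_le hf c d hs x

/-- Interior regularity: a square-integrable function whose second derivative off a finite set is
square-integrable has a square-integrable first derivative. -/
theorem exists_isW22 {X : Set ℝ} (hX : X.Finite) (u f : L2R)
    (h : ∀ φ, IsTestFunction Xᶜ φ → ∫ x, u x * deriv (deriv φ) x = ∫ x, f x * φ x) :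
    ∃ g : L2R, IsW22 X u g f := by
  have Lu := locallyIntegrable_L2 u
  have Lf := locallyIntegrable_L2 f
  have C1 : ∀ e, Continuous (primitive e f) := fun e => continuous_primitive e Lf
  have C2 : ∀ e e', Continuous (primitive e' (primitive e f)) := fun e e' =>
    continuous_primitive e' (C1 e).locallyIntegrable
  have rep : ∀ I : Set ℝ, IsOpen I → I.OrdConnected → I ⊆ Xᶜ →
      ∃ c d, ∀ᵐ x, x ∈ I → u x = primitive d (primitive c f) x := fun I hI hc hIX =>
    ae_eq_primitive_of_weakDeriv_two hI hc Lu Lf fun φ hφ => h φ (hφ.mono hIX)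
  -- Each point receives the constants of the representation valid just to its right. They do not
  -- vary along intervals that avoid `X`, so `U` and `G` are global representatives of `u` and its
  -- derivative.
  have hloc : ∀ x : ℝ, ∃ c d : ℂ, ∃ b, x < b ∧
      ∀ᵐ y, y ∈ Set.Ioo x b → u y = primitive d (primitive c f) y := by
    intro x
    obtain ⟨b, hb, hs⟩ := exists_Ioo_right_subset hX x
    obtain ⟨c, d, hcd⟩ := rep _ isOpen_Ioo Set.ordConnected_Ioo hs
    exact ⟨c, d, b, hb, hcd⟩
  choose c d r hr hcd using hloc
  set G : ℝ → ℂ := fun x => primitive (c x) f x with hG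
  set U : ℝ → ℂ := fun x => primitive (d x) (primitive (c x) f) x with hU
  have hconst : ∀ I : Set ℝ, IsOpen I → I.OrdConnected → I ⊆ Xᶜ →
      ∃ c₀ d₀, (∀ᵐ x, x ∈ I → u x = primitive d₀ (primitive c₀ f) x) ∧
        (∀ x ∈ I, G x = primitive c₀ f x) ∧
        ∀ x ∈ I, U x = primitive d₀ (primitive c₀ f) x := by
    intro I hI hc hIX
    obtain ⟨c₀, d₀, h0⟩ := rep I hI hc hIX
    have key : ∀ x ∈ I, c x = c₀ ∧ d x = d₀ := by
      intro x hx
      obtain ⟨ε, hε, hs⟩ := Metric.isOpen_iff.1 hI x hx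
      have hb : x < min (r x) (x + ε) := lt_min (hr x) (by linarith)
      refine eq_of_primitive_primitive_ae_eq Lf hb ?_
      filter_upwards [h0, hcd x] with y h1 h2 hy
      rw [← h2 ⟨hy.1, hy.2.trans_le (min_le_left _ _)⟩, ← h1 (hs ?_)]
      rw [Metric.mem_ball, Real.dist_eq, abs_lt]
      have := hy.2.trans_le (min_le_right _ _)
      constructor <;> linarith [hy.1]
    refine ⟨c₀, d₀, h0, fun x hx => ?_, fun x hx => ?_⟩
    · simp only [hG, (key x hx).1]
    · simp only [hU, (key x hx).1, (key x hx).2]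
  have hball : ∀ x ∉ X, ∃ ε > 0, Metric.ball x ε ⊆ Xᶜ := fun x hx =>
    Metric.isOpen_iff.1 hX.isClosed.isOpen_compl x hx
  have hX0 : ∀ᵐ x : ℝ, x ∉ X := hX.countable.ae_notMem _
  have hrestr : volume.restrict Xᶜ = (volume : Measure ℝ) := Measure.restrict_eq_self_of_ae_mem hX0
  have hderiv : ∀ x ∉ X, HasDerivAt U (G x) x := by
    intro x hx
    obtain ⟨ε, hε, hs⟩ := hball x hx
    obtain ⟨c₀, d₀, -, h1, h2⟩ := hconst _ Metric.isOpen_ball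
      (Real.ball_eq_Ioo x ε ▸ Set.ordConnected_Ioo) hs
    rw [h1 x (Metric.mem_ball_self hε)]
    refine (hasDerivAt_primitive d₀ (C1 c₀) x).congr_of_eventuallyEq ?_
    exact Set.EqOn.eventuallyEq_of_mem h2 (Metric.ball_mem_nhds x hε)
  have hGc : ContinuousOn G Xᶜ := by
    intro x hx
    obtain ⟨ε, hε, hs⟩ := hball x hx
    obtain ⟨c₀, d₀, -, h1, -⟩ := hconst _ Metric.isOpen_ball
      (Real.ball_eq_Ioo x ε ▸ Set.ordConnected_Ioo) hs
    refine ContinuousAt.continuousWithinAt ((C1 c₀).continuousAt.congr ?_)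
    exact (Set.EqOn.eventuallyEq_of_mem h1 (Metric.ball_mem_nhds x hε)).symm
  have hGm : AEStronglyMeasurable G volume := by
    rw [← hrestr]
    exact hGc.aestronglyMeasurable hX.isClosed.isOpen_compl.measurableSet
  have hUu : ∀ᵐ x, u x = U x := by
    have hnull : volume {x | x ∉ X ∧ u x ≠ U x} = 0 := by
      refine measure_null_of_locally_null _ fun x hx => ?_
      obtain ⟨ε, hε, hs⟩ := hball x hx.1
      obtain ⟨c₀, d₀, h0, -, h2⟩ := hconst _ Metric.isOpen_ball
        (Real.ball_eq_Ioo x ε ▸ Set.ordConnected_Ioo) hs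
      refine ⟨_, inter_mem_nhdsWithin _ (Metric.ball_mem_nhds x hε), ?_⟩
      have h0' : volume {y | ¬(y ∈ Metric.ball x ε → u y = primitive d₀ (primitive c₀ f) y)} = 0 :=
        h0
      refine measure_mono_null (fun y hy => ?_) h0'
      refine fun hyc => hy.1.2 ?_
      rw [hyc hy.2, h2 y hy.2]
    have := measure_eq_zero_iff_ae_notMem.1 hnull
    filter_upwards [this, hX0] with x h1 h2
    by_contra hc
    exact h1 ⟨h2, hc⟩
  -- On each side of a point of `X`, `G` coincides with a function continuous up to that point.
  have hGloc : LocallyIntegrable fun x => ‖G x‖ ^ 2 := by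
    have key : ∀ a b, a < b → Set.Ioo a b ⊆ Xᶜ → IntegrableOn (fun x => ‖G x‖ ^ 2)
        (Set.Ioo a b) := by
      intro a b hab hs
      obtain ⟨c₀, d₀, -, h1, -⟩ := hconst _ isOpen_Ioo Set.ordConnected_Ioo hs
      refine IntegrableOn.congr_fun (f := fun x => ‖primitive c₀ f x‖ ^ 2) ?_ (fun x hx => ?_)
        measurableSet_Ioo
      · exact (((C1 c₀).norm.pow 2).integrableOn_Icc (a := a) (b := b)).mono_set
          Set.Ioo_subset_Icc_self
      · simp only [h1 x hx]
    intro x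
    obtain ⟨a, ha, hsa⟩ := exists_Ioo_left_subset hX x
    obtain ⟨b, hb, hsb⟩ := exists_Ioo_right_subset hX x
    refine ⟨Set.Ioo a b, Ioo_mem_nhds ha hb, ?_⟩
    have h1 := ((key a x ha hsa).union (integrableOn_singleton (x := x) (by simp) (by simp))).union
      (key x b hb hsb)
    refine h1.mono_set fun y hy => ?_
    rcases lt_trichotomy y x with hyx | rfl | hyx
    · exact Or.inl (Or.inl ⟨hy.1, hyx⟩)
    · exact Or.inl (Or.inr rfl)
    · exact Or.inr ⟨hyx, hy.2⟩
  obtain ⟨M, hM, hXM⟩ := hX.isBounded.subset_ball_lt 0 0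
  rw [Real.ball_eq_Ioo, zero_sub, zero_add] at hXM
  have hGL2 : MemLp G 2 volume := by
    rw [memLp_two_iff_integrable_sq_norm hGm, ← integrableOn_univ]
    have hhalf : ∀ (S : Set ℝ) (s : ℝ), IsOpen S → S.OrdConnected → S ⊆ Xᶜ → |s| = 1 →
        (∀ x ∈ S, x + s ∈ S) → IntegrableOn (fun x => ‖G x‖ ^ 2) S := by
      intro S s hS hSc hSX hs hSs
      obtain ⟨c₀, d₀, h0, h1, -⟩ := hconst S hS hSc hSX
      have := memLp_primitive_of_ae_eq hS.measurableSet hs hSs h0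
      rw [memLp_two_iff_integrable_sq_norm (C1 c₀).aestronglyMeasurable] at this
      refine IntegrableOn.congr_fun (f := fun x => ‖primitive c₀ f x‖ ^ 2) this (fun x hx => ?_)
        hS.measurableSet
      simp only [h1 x hx]
    have hr := hhalf (Set.Ioi M) 1 isOpen_Ioi Set.ordConnected_Ioi
      (fun x hx hxX => absurd (hXM hxX).2 (not_lt.2 (le_of_lt hx))) (by simp)
      (fun x hx => by simp only [Set.mem_Ioi] at hx ⊢; linarith)
    have hl := hhalf (Set.Iio (-M)) (-1) isOpen_Iio Set.ordConnected_Iio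
      (fun x hx hxX => absurd (hXM hxX).1 (not_lt.2 (le_of_lt hx))) (by simp)
      (fun x hx => by simp only [Set.mem_Iio] at hx ⊢; linarith)
    refine ((hl.union (hGloc.integrableOn_isCompact (isCompact_Icc (a := -M) (b := M)))).union
      hr).mono_set fun x _ => ?_
    rcases lt_or_ge x (-M) with h1 | h1
    · exact Or.inl (Or.inl h1)
    · rcases le_or_gt x M with h2 | h2
      · exact Or.inl (Or.inr ⟨h1, h2⟩)
      · exact Or.inr h2
  have hgG := hGL2.coeFn_toLp
  set g : L2R := hGL2.toLp G
  have Lg := locallyIntegrable_L2 g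
  have hweak : IsWeakDeriv X u g := by
    intro φ hφ
    have hd : ∀ x, HasDerivAt (fun x => U x * φ x) (G x * φ x + U x * deriv φ x) x := by
      intro x
      by_cases hx : x ∈ X
      -- Near a point of `X` the product vanishes identically, so jumps of `U` there do not matter.
      · have hnt : x ∉ tsupport φ := fun hc => hφ.support_subset hc hx
        have he : φ =ᶠ[𝓝 x] 0 := notMem_tsupport_iff_eventuallyEq.1 hnt
        rw [he.eq_of_nhds, he.deriv_eq]
        simp only [Pi.zero_apply, mul_zero, zero_add]
        have : deriv (0 : ℝ → ℂ) x = 0 := by simp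
        rw [this, mul_zero]
        refine (hasDerivAt_const x (0 : ℂ)).congr_of_eventuallyEq ?_
        filter_upwards [he] with y hy
        simp [hy]
      · exact (hderiv x hx).mul (hφ.differentiable x).hasDerivAt
    have i1 : Integrable fun x => G x * φ x :=
      (hφ.integrable_mul Lg).congr (hgG.mono fun x hx => by simp only [hx])
    have i2 : Integrable fun x => U x * deriv φ x :=
      (hφ.deriv.integrable_mul Lu).congr (hUu.mono fun x hx => by simp only [hx])
    have i3 : Integrable fun x => U x * φ x :=
      (hφ.integrable_mul Lu).congr (hUu.mono fun x hx => by simp only [hx])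
    have hz := integral_eq_zero_of_hasDerivAt_of_integrable hd (i1.add i2) i3
    rw [integral_add i1 i2] at hz
    have e1 : ∫ x, u x * deriv φ x = ∫ x, U x * deriv φ x :=
      integral_congr_ae (hUu.mono fun x hx => by simp only [hx])
    have e2 : ∫ x, g x * φ x = ∫ x, G x * φ x :=
      integral_congr_ae (hgG.mono fun x hx => by simp only [hx])
    rw [e1, e2]
    linear_combination hz
  refine ⟨g, hweak, fun φ hφ => ?_⟩
  have h1 := hweak (deriv φ) hφ.deriv
  rw [h φ hφ] at h1
  rw [h1, neg_neg]

/-! ### Self-adjointness in terms of graphs -/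

section SelfAdjoint

variable {H : Type*} [NormedAddCommGroup H] [InnerProductSpace ℂ H] [CompleteSpace H]
  {A : H →ₗ.[ℂ] H}

/-- The graph equals its own adjoint relation. The forward direction is symmetry; the backward one
is the maximality that puts functions into the domain. -/
theorem mem_graph_iff_of_isSelfAdjoint (hA : IsSelfAdjoint A) {u v : H} :
    (u, v) ∈ A.graph ↔ ∀ p q, (p, q) ∈ A.graph → inner ℂ q u = inner ℂ p v := by
  have h := LinearPMap.adjoint_graph_eq_graph_adjoint hA.dense_domain
  rw [LinearPMap.isSelfAdjoint_def.1 hA] at h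
  conv_lhs => rw [h]
  simp only [Submodule.mem_adjoint_iff, sub_eq_zero]

theorem isSelfAdjoint_of_mem_graph_iff (hd : Dense (A.domain : Set H))
    (h : ∀ u v, (u, v) ∈ A.graph ↔ ∀ p q, (p, q) ∈ A.graph → inner ℂ q u = inner ℂ p v) :
    IsSelfAdjoint A := by
  rw [LinearPMap.isSelfAdjoint_def]
  refine LinearPMap.eq_of_eq_graph ?_
  rw [LinearPMap.adjoint_graph_eq_graph_adjoint hd]
  ext ⟨u, v⟩
  rw [h]
  simp only [Submodule.mem_adjoint_iff, sub_eq_zero]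

end SelfAdjoint

theorem inner_L2 {μ : Measure ℝ} (u v : Lp ℂ 2 μ) :
    inner ℂ u v = ∫ x, v x * conj (u x) ∂μ := by
  rw [L2.inner_def]
  simp only [RCLike.inner_apply]

/-! ### Restriction to a subset and splitting of operators -/

section Restriction

variable {S : Set ℝ} (hS : MeasurableSet S)

/-- Multiplication by the indicator function of `S`. -/
noncomputable def cutL2 (u : L2R) : L2R := ((Lp.memLp u).indicator hS).toLp _

theorem coeFn_cutL2 (u : L2R) : cutL2 hS u =ᵐ[volume] S.indicator u := MemLp.coeFn_toLp _

theorem coeFn_restrictL2 (S : Set ℝ) (u : L2R) : restrictL2 S u =ᵐ[volume.restrict S] u :=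
  LpToLpRestrictCLM_coeFn ℂ S u

theorem restrictL2_eq_iff (u : L2R) (p : Lp ℂ 2 ((volume : Measure ℝ).restrict S)) :
    restrictL2 S u = p ↔ u =ᵐ[volume.restrict S] p := by
  rw [Lp.ext_iff]
  exact ⟨fun h => (coeFn_restrictL2 S u).symm.trans h, fun h => (coeFn_restrictL2 S u).trans h⟩

theorem restrictL2_eq_restrictL2_iff (u w : L2R) :
    restrictL2 S u = restrictL2 S w ↔ u =ᵐ[volume.restrict S] w := by
  rw [restrictL2_eq_iff]
  exact ⟨fun h => h.trans (coeFn_restrictL2 S w), fun h => h.trans (coeFn_restrictL2 S w).symm⟩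

theorem cutL2_congr {u w : L2R} (h : restrictL2 S u = restrictL2 S w) :
    cutL2 hS u = cutL2 hS w := by
  rw [restrictL2_eq_restrictL2_iff, EventuallyEq, ae_restrict_iff' hS] at h
  refine Lp.ext ?_
  filter_upwards [coeFn_cutL2 hS u, coeFn_cutL2 hS w, h] with x h1 h2 h3
  rw [h1, h2]
  by_cases hx : x ∈ S
  · simp [hx, h3 hx]
  · simp [hx]

theorem restrictL2_cutL2 (u : L2R) : restrictL2 S (cutL2 hS u) = restrictL2 S u := by
  rw [restrictL2_eq_restrictL2_iff, EventuallyEq, ae_restrict_iff' hS]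
  filter_upwards [coeFn_cutL2 hS u] with x h1 hx
  rw [h1, Set.indicator_of_mem hx]

theorem restrictL2_cutL2_of_disjoint {T : Set ℝ} (hT : MeasurableSet T) (h : Disjoint S T)
    (u : L2R) : restrictL2 T (cutL2 hS u) = 0 := by
  rw [← map_zero (restrictL2 T), restrictL2_eq_restrictL2_iff, EventuallyEq, ae_restrict_iff' hT]
  filter_upwards [coeFn_cutL2 hS u, Lp.coeFn_zero ℂ 2 (volume : Measure ℝ)] with x h1 h2 hx
  rw [h1, h2, Set.indicator_of_notMem (fun hxS => Set.disjoint_left.1 h hxS hx)]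
  rfl

/-- Restriction followed by extension by zero is the orthogonal projection `cutL2`, so pairings in
`L₂(S)` become pairings in `L₂(ℝ)`. -/
theorem inner_restrictL2 (u w : L2R) :
    inner ℂ (restrictL2 S u) (restrictL2 S w) = inner ℂ u (cutL2 hS w) := by
  rw [inner_L2, inner_L2]
  have h1 : ∫ x, restrictL2 S w x * conj (restrictL2 S u x) ∂(volume.restrict S) =
      ∫ x in S, w x * conj (u x) := by
    refine integral_congr_ae ?_
    filter_upwards [coeFn_restrictL2 S u, coeFn_restrictL2 S w] with x h1 h2
    rw [h1, h2]
  rw [h1, ← integral_indicator hS]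
  refine integral_congr_ae ?_
  filter_upwards [coeFn_cutL2 hS w] with x h
  rw [h]
  by_cases hx : x ∈ S <;> simp [hx]

theorem restrictL2_surjective (hS : MeasurableSet S) : Function.Surjective (restrictL2 S) := by
  intro p
  have hp : MemLp (S.indicator p) 2 volume :=
    (memLp_indicator_iff_restrict hS).2 (Lp.memLp p)
  refine ⟨hp.toLp, ?_⟩
  rw [restrictL2_eq_iff, EventuallyEq, ae_restrict_iff' hS]
  filter_upwards [hp.coeFn_toLp] with x h hx
  rw [h, Set.indicator_of_mem hx]

theorem cutL2_Iio_add_cutL2_Ioi (a : ℝ) (u : L2R) :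
    cutL2 (measurableSet_Iio (a := a)) u + cutL2 (measurableSet_Ioi (a := a)) u = u := by
  refine Lp.ext ?_
  have hb : ∀ᵐ x : ℝ, x ≠ a := by simp [ae_iff]
  filter_upwards [coeFn_cutL2 (measurableSet_Iio (a := a)) u,
    coeFn_cutL2 (measurableSet_Ioi (a := a)) u, Lp.coeFn_add
    (cutL2 (measurableSet_Iio (a := a)) u) (cutL2 (measurableSet_Ioi (a := a)) u), hb]
    with x h1 h2 h3 hx
  rw [h3, Pi.add_apply, h1, h2]
  rcases lt_or_gt_of_ne hx with h | h
  · simp [h, h.le]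
  · simp [h, h.le]

variable {A : L2R →ₗ.[ℂ] L2R}

/-- The graph of the part of `A` in `L₂(S)`. -/
noncomputable def partGraph (A : L2R →ₗ.[ℂ] L2R) (S : Set ℝ) :
    Submodule ℂ (Lp ℂ 2 ((volume : Measure ℝ).restrict S) ×
      Lp ℂ 2 ((volume : Measure ℝ).restrict S)) :=
  A.graph.map ((restrictL2 S).toLinearMap.prodMap (restrictL2 S).toLinearMap)

theorem mem_partGraph {p q : Lp ℂ 2 ((volume : Measure ℝ).restrict S)} :
    (p, q) ∈ partGraph A S ↔ ∃ u v, (u, v) ∈ A.graph ∧ restrictL2 S u = p ∧ restrictL2 S v = q := by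
  simp only [partGraph, Submodule.mem_map, Prod.exists, LinearMap.prodMap_apply, Prod.mk.injEq,
    ContinuousLinearMap.coe_coe]

/-- A reducing subspace carries a self-adjoint part: pairing against the restricted graph is pairing
the cut functions against the graph of `A`, so the adjoint criterion for `A` transfers. -/
theorem exists_isSelfAdjoint_part (hA : IsSelfAdjoint A)
    (h : ∀ u v, (u, v) ∈ A.graph → (cutL2 hS u, cutL2 hS v) ∈ A.graph) :
    ∃ B : Lp ℂ 2 ((volume : Measure ℝ).restrict S) →ₗ.[ℂ]
        Lp ℂ 2 ((volume : Measure ℝ).restrict S),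
      IsSelfAdjoint B ∧ ∀ u v, (restrictL2 S u, restrictL2 S v) ∈ B.graph ↔
        (cutL2 hS u, cutL2 hS v) ∈ A.graph := by
  have cut0 : cutL2 hS 0 = 0 := by
    refine Lp.ext ((coeFn_cutL2 hS 0).trans ?_)
    filter_upwards [Lp.coeFn_zero ℂ 2 (volume : Measure ℝ)] with x hx
    by_cases hxS : x ∈ S <;> simp [hxS]
  have mem : ∀ u v, (restrictL2 S u, restrictL2 S v) ∈ partGraph A S ↔
      (cutL2 hS u, cutL2 hS v) ∈ A.graph := by
    intro u v
    rw [mem_partGraph]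
    constructor
    · rintro ⟨u', v', h', hu, hv⟩
      rw [← cutL2_congr hS hu, ← cutL2_congr hS hv]
      exact h u' v' h'
    · exact fun h' => ⟨_, _, h', restrictL2_cutL2 hS u, restrictL2_cutL2 hS v⟩
  have hfun : ∀ x ∈ partGraph A S, x.1 = 0 → x.2 = 0 := by
    rintro ⟨p, q⟩ hpq hp
    obtain ⟨v, rfl⟩ := restrictL2_surjective hS q
    simp only at hp
    subst hp
    rw [← map_zero (restrictL2 S), mem, cut0] at hpq
    have := A.graph_fst_eq_zero_snd hpq rfl
    show restrictL2 S v = 0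
    rw [← restrictL2_cutL2 hS, this, map_zero]
  have hgraph : (partGraph A S).toLinearPMap.graph = partGraph A S :=
    Submodule.toLinearPMap_graph_eq _ hfun
  refine ⟨(partGraph A S).toLinearPMap, ?_, fun u v => by rw [hgraph, mem]⟩
  refine isSelfAdjoint_of_mem_graph_iff ?_ fun p q => ?_
  · refine ((restrictL2_surjective hS).denseRange.dense_image (restrictL2 S).continuous
      hA.dense_domain).mono ?_
    rintro _ ⟨u, hu, rfl⟩
    obtain ⟨v, hv⟩ := LinearPMap.mem_domain_iff.1 hu
    refine LinearPMap.mem_domain_iff.2 ⟨restrictL2 S v, ?_⟩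
    rw [hgraph, mem]
    exact h u v hv
  · obtain ⟨u, rfl⟩ := restrictL2_surjective hS p
    obtain ⟨v, rfl⟩ := restrictL2_surjective hS q
    rw [hgraph, mem, mem_graph_iff_of_isSelfAdjoint hA]
    constructor
    · intro h1 p' q' hp
      obtain ⟨u', v', h', rfl, rfl⟩ := mem_partGraph.1 hp
      rw [inner_restrictL2 hS, inner_restrictL2 hS]
      exact h1 u' v' h'
    · intro h1 u' v' h'
      rw [← inner_restrictL2 hS, ← inner_restrictL2 hS]
      exact h1 _ _ (mem_partGraph.2 ⟨u', v', h', rfl, rfl⟩)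

/-- A self-adjoint operator that is reduced by `L₂(-∞, a)` splits at `a`. -/
theorem splitsAt_of_cutL2_mem_graph (hA : IsSelfAdjoint A) {a : ℝ}
    (h : ∀ u v, (u, v) ∈ A.graph →
      (cutL2 (measurableSet_Iio (a := a)) u, cutL2 (measurableSet_Iio (a := a)) v) ∈ A.graph) :
    SplitsAt A a := by
  -- The point `a` is null, so the right cut is the identity minus the left cut, and graphs are
  -- linear.
  have h' : ∀ u v, (u, v) ∈ A.graph →
      (cutL2 (measurableSet_Ioi (a := a)) u, cutL2 (measurableSet_Ioi (a := a)) v) ∈ A.graph := by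
    intro u v huv
    have := A.graph.sub_mem huv (h u v huv)
    convert! this using 1
    refine Prod.ext ?_ ?_
    · exact eq_sub_of_add_eq' (cutL2_Iio_add_cutL2_Ioi a u)
    · exact eq_sub_of_add_eq' (cutL2_Iio_add_cutL2_Ioi a v)
  obtain ⟨A₁, hA₁, h₁⟩ := exists_isSelfAdjoint_part measurableSet_Iio hA h
  obtain ⟨A₂, hA₂, h₂⟩ := exists_isSelfAdjoint_part measurableSet_Ioi hA h'
  refine ⟨A₁, A₂, hA₁, hA₂, fun u v => ?_⟩
  rw [h₁, h₂]
  refine ⟨fun huv => ⟨h u v huv, h' u v huv⟩, fun ⟨hm, hp⟩ => ?_⟩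
  have := A.graph.add_mem hm hp
  rwa [Prod.mk_add_mk, cutL2_Iio_add_cutL2_Ioi, cutL2_Iio_add_cutL2_Ioi] at this

/-- The left cut has the same left component and zero right component, and `(0, 0)` lies in every
graph. -/
theorem SplitsAt.cutL2_mem_graph {a : ℝ} (h : SplitsAt A a) {u v : L2R} (huv : (u, v) ∈ A.graph) :
    (cutL2 (measurableSet_Iio (a := a)) u, cutL2 (measurableSet_Iio (a := a)) v) ∈ A.graph := by
  obtain ⟨A₁, A₂, -, -, hs⟩ := h
  have hd : Disjoint (Set.Iio a) (Set.Ioi a) :=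
    Set.disjoint_left.2 fun x hx hx' => lt_asymm (Set.mem_Iio.1 hx) (Set.mem_Ioi.1 hx')
  rw [hs, restrictL2_cutL2, restrictL2_cutL2,
    restrictL2_cutL2_of_disjoint _ measurableSet_Ioi hd,
    restrictL2_cutL2_of_disjoint _ measurableSet_Ioi hd]
  exact ⟨((hs u v).1 huv).1, A₂.graph.zero_mem⟩

end Restriction

/-! ### Truncation of weak derivatives and construction of cutoffs -/

section Smooth

variable {X : Set ℝ}

theorem isWeakDeriv_of_isTestFunction {U : Set ℝ} {χ : ℝ → ℂ} (hχ : IsTestFunction U χ)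
    {u g : L2R} (hu : u =ᵐ[volume] χ) (hg : g =ᵐ[volume] deriv χ) : IsWeakDeriv X u g := by
  intro φ hφ
  have h := integral_primitive_mul_deriv (χ 0) hχ.deriv.continuous.locallyIntegrable hφ
  rw [primitive_deriv hχ.smooth] at h
  have e1 : ∫ x, u x * deriv φ x = ∫ x, χ x * deriv φ x :=
    integral_congr_ae (hu.mono fun x hx => by simp only [hx])
  have e2 : ∫ x, g x * φ x = ∫ x, deriv χ x * φ x :=
    integral_congr_ae (hg.mono fun x hx => by simp only [hx])
  rw [e1, e2, h]

/-- The set `X` contains the frontier of `S`, and `φ` vanishes near `X`; hence near each point the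
truncation coincides with `φ` or with zero. -/
theorem isTestFunction_indicator {S : Set ℝ} (hS : frontier S ⊆ X) {φ : ℝ → ℂ}
    (hφ : IsTestFunction Xᶜ φ) :
    IsTestFunction Xᶜ (S.indicator φ) ∧ deriv (S.indicator φ) = S.indicator (deriv φ) := by
  have key : ∀ x, (S.indicator φ =ᶠ[𝓝 x] φ ∧ S.indicator (deriv φ) x = deriv φ x) ∨
      (S.indicator φ =ᶠ[𝓝 x] 0 ∧ S.indicator (deriv φ) x = 0) := by
    intro x
    by_cases hx : x ∈ X
    · right
      have he : φ =ᶠ[𝓝 x] 0 :=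
        notMem_tsupport_iff_eventuallyEq.1 fun hc => hφ.support_subset hc hx
      have hd : deriv φ x = 0 := by rw [he.deriv_eq]; simp
      refine ⟨he.mono fun y hy => ?_, ?_⟩
      · by_cases hyS : y ∈ S <;> simp [hyS, hy]
      · by_cases hxS : x ∈ S <;> simp [hxS, hd]
    · have hxf : x ∉ frontier S := fun hc => hx (hS hc)
      by_cases hxS : x ∈ S
      · left
        have hn : S ∈ 𝓝 x := by
          rw [← mem_interior_iff_mem_nhds]
          by_contra hc
          exact hxf ⟨subset_closure hxS, hc⟩
        exact ⟨by filter_upwards [hn] with y hy using Set.indicator_of_mem hy _,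
          Set.indicator_of_mem hxS _⟩
      · right
        have hn : Sᶜ ∈ 𝓝 x := by
          rw [← mem_interior_iff_mem_nhds, interior_compl]
          exact fun hc => hxf ⟨hc, fun hi => hxS (interior_subset hi)⟩
        exact ⟨by filter_upwards [hn] with y hy using Set.indicator_of_notMem hy _,
          Set.indicator_of_notMem hxS _⟩
  have hsup : Function.support (S.indicator φ) ⊆ Function.support φ := by
    rw [Set.support_indicator]
    exact Set.inter_subset_right
  refine ⟨⟨?_, ?_, ?_⟩, ?_⟩
  · rw [contDiff_iff_contDiffAt]
    intro x
    rcases key x with ⟨h, -⟩ | ⟨h, -⟩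
    · exact hφ.smooth.contDiffAt.congr_of_eventuallyEq h
    · exact contDiffAt_const.congr_of_eventuallyEq h
  · exact hφ.compact_support.mono hsup
  · exact (closure_mono hsup).trans hφ.support_subset
  · ext x
    rcases key x with ⟨h, hd⟩ | ⟨h, hd⟩
    · rw [h.deriv_eq, hd]
    · rw [h.deriv_eq, hd]; simp

/-- The indicator is moved onto the test function, which remains a test function. -/
theorem IsWeakDeriv.cutL2 {S : Set ℝ} (hS : MeasurableSet S) (hSX : frontier S ⊆ X)
    {u g : L2R} (h : IsWeakDeriv X u g) : IsWeakDeriv X (cutL2 hS u) (cutL2 hS g) := by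
  intro φ hφ
  obtain ⟨h1, h2⟩ := isTestFunction_indicator hSX hφ
  have h3 := h _ h1
  rw [h2] at h3
  have e1 : ∫ x, PointInteraction.cutL2 hS u x * deriv φ x =
      ∫ x, u x * S.indicator (deriv φ) x := by
    refine integral_congr_ae ?_
    filter_upwards [coeFn_cutL2 hS u] with x hx
    rw [hx]
    by_cases hxS : x ∈ S <;> simp [hxS]
  have e2 : ∫ x, PointInteraction.cutL2 hS g x * φ x = ∫ x, g x * S.indicator φ x := by
    refine integral_congr_ae ?_
    filter_upwards [coeFn_cutL2 hS g] with x hx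
    rw [hx]
    by_cases hxS : x ∈ S <;> simp [hxS]
  rw [e1, e2, h3]

/-- A bump of radius below the gap between `a` and the rest of `X` is constant near every point of
`X`. -/
theorem exists_isCutoff (hX : X.Finite) (a : ℝ) :
    ∃ χ : ℝ → ℂ, IsCutoff X χ ∧ (∀ᶠ x in 𝓝 a, χ x = 1) ∧
      ∀ y ∈ X, y ≠ a → ∀ᶠ x in 𝓝 y, χ x = 0 := by
  obtain ⟨ε, hε, h⟩ := exists_pos_forall_abs_lt hX a
  let b : ContDiffBump a := ⟨ε / 4, ε / 2, by positivity, by linarith⟩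
  have htest : IsTestFunction Set.univ (fun x => ((b x : ℝ) : ℂ)) :=
    isTestFunction_ofReal b.contDiff b.hasCompactSupport (Set.subset_univ _)
  have hone : ∀ᶠ x in 𝓝 a, ((b x : ℝ) : ℂ) = 1 := by
    filter_upwards [b.eventuallyEq_one] with x hx
    simp [hx]
  have hzero : ∀ y ∈ X, y ≠ a → ∀ᶠ x in 𝓝 y, ((b x : ℝ) : ℂ) = 0 := by
    intro y hy hya
    have : y ∉ tsupport b := by
      rw [b.tsupport_eq]
      intro hc
      refine hya (h y hy ?_)
      rw [Metric.mem_closedBall, Real.dist_eq] at hc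
      have : b.rOut = ε / 2 := rfl
      linarith
    filter_upwards [notMem_tsupport_iff_eventuallyEq.1 this] with x hx
    simp [hx]
  refine ⟨_, ⟨htest, htest.deriv.smooth, htest.deriv.compact_support, fun y hy hyX => ?_⟩,
    hone, hzero⟩
  refine notMem_tsupport_iff_eventuallyEq.2 ?_ hy
  by_cases hya : y = a
  · subst hya
    have : (fun x => ((b x : ℝ) : ℂ)) =ᶠ[𝓝 y] fun _ => 1 := hone
    exact this.deriv.trans (by simp; rfl)
  · have : (fun x => ((b x : ℝ) : ℂ)) =ᶠ[𝓝 y] fun _ => 0 := hzero y hyX hya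
    exact this.deriv.trans (by simp; rfl)

end Smooth

/-! ### Locality of one-sided values -/

section Values

theorem rightValue_congr {u w : L2R} {a b : ℝ} (hab : a < b)
    (h : ∀ᵐ y, y ∈ Set.Ioo a b → u y = w y) : rightValue u a = rightValue w a := by
  have e1 : ∀ᶠ x in 𝓝[>] a ⊓ ae volume, x ∈ Set.Ioo a b :=
    (inf_le_left : _ ≤ 𝓝[>] a) (Ioo_mem_nhdsGT hab)
  have e2 : ∀ᶠ x in 𝓝[>] a ⊓ ae volume, x ∈ Set.Ioo a b → u x = w x :=
    (inf_le_right : 𝓝[>] a ⊓ ae volume ≤ _) h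
  have e3 : u =ᶠ[𝓝[>] a ⊓ ae volume] w := by filter_upwards [e1, e2] with x h1 h2 using h2 h1
  rw [rightValue, rightValue, limUnder, limUnder, map_congr e3]

theorem leftValue_congr {u w : L2R} {a b : ℝ} (hab : a < b)
    (h : ∀ᵐ y, y ∈ Set.Ioo a b → u y = w y) : leftValue u b = leftValue w b := by
  have e1 : ∀ᶠ x in 𝓝[<] b ⊓ ae volume, x ∈ Set.Ioo a b :=
    (inf_le_left : _ ≤ 𝓝[<] b) (Ioo_mem_nhdsLT hab)
  have e2 : ∀ᶠ x in 𝓝[<] b ⊓ ae volume, x ∈ Set.Ioo a b → u x = w x :=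
    (inf_le_right : 𝓝[<] b ⊓ ae volume ≤ _) h
  have e3 : u =ᶠ[𝓝[<] b ⊓ ae volume] w := by filter_upwards [e1, e2] with x h1 h2 using h2 h1
  rw [leftValue, leftValue, limUnder, limUnder, map_congr e3]

theorem values_congr {u w : L2R} {I : Set ℝ} (hI : IsOpen I) {x : ℝ} (hx : x ∈ I)
    (h : ∀ᵐ y, y ∈ I → u y = w y) :
    rightValue u x = rightValue w x ∧ leftValue u x = leftValue w x := by
  obtain ⟨ε, hε, hs⟩ := Metric.isOpen_iff.1 hI x hx
  rw [Real.ball_eq_Ioo] at hs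
  exact ⟨rightValue_congr (by linarith : x < x + ε)
      (h.mono fun y hy hyx => hy (hs ⟨by linarith [hyx.1], hyx.2⟩)),
    leftValue_congr (by linarith : x - ε < x)
      (h.mono fun y hy hyx => hy (hs ⟨hyx.1, by linarith [hyx.2]⟩))⟩

theorem hasValues_of_continuous {u : L2R} {U : ℝ → ℂ} (hU : Continuous U)
    (h : u =ᵐ[volume] U) (x : ℝ) : HasRightValue u x (U x) ∧ HasLeftValue u x (U x) :=
  ⟨hasRightValue_of_ae (lt_add_one x) hU (h.mono fun _ hy _ => hy),
    hasLeftValue_of_ae (sub_one_lt x) hU (h.mono fun _ hy _ => hy)⟩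

theorem values_zero (x : ℝ) : rightValue 0 x = 0 ∧ leftValue 0 x = 0 := by
  have := hasValues_of_continuous (u := 0) (U := fun _ => 0) continuous_const
    (Lp.coeFn_zero ℂ 2 (volume : Measure ℝ)) x
  exact ⟨this.1.eq, this.2.eq⟩

theorem isWeakDeriv_zero (X : Set ℝ) : IsWeakDeriv X 0 0 := by
  intro φ _
  have h : ∀ ψ : ℝ → ℂ, ∫ x, (0 : L2R) x * ψ x = 0 := by
    intro ψ
    rw [← integral_zero ℝ ℂ]
    refine integral_congr_ae ?_
    filter_upwards [Lp.coeFn_zero ℂ 2 (volume : Measure ℝ)] with x hx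
    rw [hx]
    simp
  rw [h, h, neg_zero]

end Values

/-! ### From the two conditions to the boundary conditions -/

theorem isTestFunction_conj {U : Set ℝ} {φ : ℝ → ℂ} (hφ : IsTestFunction U φ) :
    IsTestFunction U (fun x => conj (φ x)) := by
  refine ⟨Complex.conjCLE.contDiff.comp hφ.smooth,
    hφ.compact_support.comp_left (g := fun z : ℂ => conj z) (map_zero _), ?_⟩
  refine (closure_mono fun x hx => ?_).trans hφ.support_subset
  intro h
  exact hx (by simp [h])

theorem deriv_conj (φ : ℝ → ℂ) : deriv (fun x => conj (φ x)) = fun x => conj (deriv φ x) :=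
  funext fun _ => deriv.star

theorem integral_green_eq_inner (u v p q : L2R) :
    ∫ x, ((-v) x * conj (p x) - u x * conj ((-q) x)) = inner ℂ q u - inner ℂ p v := by
  rw [inner_L2, inner_L2, ← integral_sub (integrable_mul_conj u q) (integrable_mul_conj v p)]
  refine integral_congr_ae ?_
  filter_upwards [Lp.coeFn_neg v, Lp.coeFn_neg q] with x h1 h2
  rw [h1, h2]
  simp only [Pi.neg_apply, map_neg]
  ring

variable {X : Set ℝ} {A : L2R →ₗ.[ℂ] L2R} {u v g p q k : L2R}

theorem MemDomain.exists_mem_graph {f : ℝ → ℂ} (h : MemDomain A f) :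
    ∃ u v : L2R, (u, v) ∈ A.graph ∧ u =ᵐ[volume] f := by
  obtain ⟨u, hu, hf⟩ := h
  obtain ⟨v, hv⟩ := LinearPMap.mem_domain_iff.1 hu
  exact ⟨u, v, hv, hf⟩

namespace IsLocalInteraction

theorem exists_isW22 (hX : X.Finite) (hA : IsLocalInteraction X A) (huv : (u, v) ∈ A.graph) :
    ∃ g, IsW22 X u g (-v) := by
  refine PointInteraction.exists_isW22 hX u (-v) fun φ hφ => ?_
  -- The inner product conjugates its first argument, so the conjugate of `φ` is inserted to test
  -- against `φ` itself.
  obtain ⟨p, q, hpq, hp, hq⟩ := hA.extends_minimal _ (isTestFunction_conj hφ)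
  have h := (mem_graph_iff_of_isSelfAdjoint hA.selfAdjoint).1 huv p q hpq
  rw [inner_L2, inner_L2] at h
  have e1 : ∫ x, u x * conj (q x) = -∫ x, u x * deriv (deriv φ) x := by
    rw [← integral_neg]
    refine integral_congr_ae ?_
    filter_upwards [hq] with x hx
    rw [hx, deriv_conj, deriv_conj]
    simp
  have e2 : ∫ x, v x * conj (p x) = -∫ x, (-v) x * φ x := by
    rw [← integral_neg]
    refine integral_congr_ae ?_
    filter_upwards [hp, Lp.coeFn_neg v] with x hx hv
    rw [hx, hv]
    simp
  rw [e1, e2] at h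
  exact neg_injective h

/-- Multiplying by a cutoff keeps the boundary data at `a` and erases them at the rest of `X`, so
Green's formula sees a single jump. -/
theorem exists_localization (hX : X.Finite) (hA : IsLocalInteraction X A)
    (huv : (u, v) ∈ A.graph) (hg : IsW22 X u g (-v)) (a : ℝ) :
    ∃ p q k, (p, q) ∈ A.graph ∧ IsW22 X p k (-q) ∧
      (rightValue p a = rightValue u a ∧ leftValue p a = leftValue u a) ∧
      (rightValue k a = rightValue g a ∧ leftValue k a = leftValue g a) ∧
      ∀ y ∈ X, y ≠ a → (rightValue p y = 0 ∧ leftValue p y = 0) ∧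
        (rightValue k y = 0 ∧ leftValue k y = 0) := by
  obtain ⟨χ, hχ, h1, h0⟩ := exists_isCutoff hX a
  obtain ⟨p, q, hpq, hp⟩ := (hA.isLocal u (LinearPMap.mem_domain_of_mem_graph huv) χ
    hχ).exists_mem_graph
  obtain ⟨k, hk⟩ := hA.exists_isW22 hX hpq
  refine ⟨p, q, k, hpq, hk, ?_⟩
  obtain ⟨I, hI1, hI, haI⟩ := eventually_nhds_iff.1 h1
  have e1 : ∀ᵐ x, x ∈ I → p x = u x := by
    filter_upwards [hp] with x hx hxI
    rw [hx, hI1 x hxI, one_mul]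
  refine ⟨values_congr hI haI e1,
    values_congr hI haI (hk.weak_deriv.ae_eq hX hg.weak_deriv hI e1), fun y hy hya => ?_⟩
  obtain ⟨J, hJ0, hJ, hyJ⟩ := eventually_nhds_iff.1 (h0 y hy hya)
  have e0 : ∀ᵐ x, x ∈ J → p x = (0 : L2R) x := by
    filter_upwards [hp, Lp.coeFn_zero ℂ 2 (volume : Measure ℝ)] with x hx hz hxJ
    rw [hx, hJ0 x hxJ, zero_mul, hz]
    rfl
  have c1 := values_congr hJ hyJ e0
  have c2 := values_congr hJ hyJ (hk.weak_deriv.ae_eq hX (isWeakDeriv_zero X) hJ e0)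
  rw [(values_zero y).1, (values_zero y).2] at c1 c2
  exact ⟨c1, c2⟩

/-- Any two functions in the domain have a continuous Wronskian. -/
theorem wronskian_eq (hX : X.Finite) (hA : IsLocalInteraction X A) (huv : (u, v) ∈ A.graph)
    (hg : IsW22 X u g (-v)) (hpq : (p, q) ∈ A.graph) (hk : IsW22 X p k (-q)) (a : ℝ) :
    wronskianRight u g p k a = wronskianLeft u g p k a := by
  obtain ⟨p', q', k', hpq', hk', hp, hkk, h0⟩ := hA.exists_localization hX hpq hk a
  have h := green_formula hX hg hk' a fun y hy hya => by
    obtain ⟨⟨h1, h2⟩, h3, h4⟩ := h0 y hy hya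
    rw [wronskianRight, wronskianLeft, h1, h2, h3, h4]
    simp
  rw [integral_green_eq_inner,
    (mem_graph_iff_of_isSelfAdjoint hA.selfAdjoint).1 huv p' q' hpq', sub_self] at h
  rw [wronskianRight, wronskianLeft, hp.1, hp.2, hkk.1, hkk.2] at h
  exact (sub_eq_zero.1 h.symm).symm

/-- Without jumps Green's formula makes the boundary form vanish, and maximality of the self-adjoint
graph gives membership. -/
theorem mem_graph_of_wronskian_eq (hX : X.Finite) (hA : IsLocalInteraction X A)
    (hg : IsW22 X u g (-v))
    (h : ∀ p q k, (p, q) ∈ A.graph → IsW22 X p k (-q) →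
      ∀ x ∈ X, wronskianRight p k u g x = wronskianLeft p k u g x) : (u, v) ∈ A.graph := by
  rw [mem_graph_iff_of_isSelfAdjoint hA.selfAdjoint]
  intro p q hpq
  obtain ⟨k, hk⟩ := hA.exists_isW22 hX hpq
  have := green_formula_zero hX hk hg (h p q k hpq hk)
  rw [integral_green_eq_inner, sub_eq_zero] at this
  rw [← inner_conj_symm, ← this, inner_conj_symm]

/-- Against a cutoff that equals `1` near `a`, the Wronskian of `u` reduces to `u'`. -/
theorem rightValue_deriv_eq_leftValue_deriv (hX : X.Finite) (hA : IsLocalInteraction X A)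
    (hcut : ∀ χ : ℝ → ℂ, IsCutoff X χ → MemDomain A χ) (huv : (u, v) ∈ A.graph)
    (hg : IsW22 X u g (-v)) (a : ℝ) : rightValue g a = leftValue g a := by
  obtain ⟨χ, hχ, h1, -⟩ := exists_isCutoff hX a
  obtain ⟨p, q, hpq, hp⟩ := (hcut χ hχ).exists_mem_graph
  obtain ⟨k, hk⟩ := hA.exists_isW22 hX hpq
  have hχ' := hχ.1.deriv.memLp.coeFn_toLp
  have hkχ : k =ᵐ[volume] deriv χ := by
    have := hk.weak_deriv.ae_eq hX (isWeakDeriv_of_isTestFunction hχ.1 hp hχ') isOpen_univ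
      (ae_of_all _ fun _ _ => rfl)
    filter_upwards [this, hχ'] with x h1 h2
    rw [h1 (Set.mem_univ x), h2]
  have v1 := hasValues_of_continuous hχ.1.continuous hp a
  have v2 := hasValues_of_continuous hχ.1.deriv.continuous hkχ a
  have d0 : deriv χ a = 0 := by
    have : χ =ᶠ[𝓝 a] fun _ => 1 := h1
    rw [this.deriv_eq]; simp
  have h := hA.wronskian_eq hX huv hg hpq hk a
  rw [wronskianRight, wronskianLeft, v1.1.eq, v1.2.eq, v2.1.eq, v2.2.eq, d0, h1.self_of_nhds] at h
  simpa using h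

/-- Neumann conditions on both sides of a point decouple the half-lines. -/
theorem splitsAt_of_rightValue_deriv_eq_zero (hX : X.Finite) (hA : IsLocalInteraction X A)
    {a : ℝ} (ha : a ∈ X)
    (hl : ∀ u v g, (u, v) ∈ A.graph → IsW22 X u g (-v) → leftValue g a = 0) :
    SplitsAt A a := by
  refine splitsAt_of_cutL2_mem_graph hA.selfAdjoint fun u v huv => ?_
  obtain ⟨g, hg⟩ := hA.exists_isW22 hX huv
  have hS : MeasurableSet (Set.Iio a) := measurableSet_Iio
  have hfr : frontier (Set.Iio a) ⊆ X := by
    rw [frontier_Iio]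
    exact Set.singleton_subset_iff.2 ha
  have hneg : cutL2 hS (-v) = -cutL2 hS v := by
    refine Lp.ext ?_
    filter_upwards [coeFn_cutL2 hS (-v), coeFn_cutL2 hS v, Lp.coeFn_neg v,
      Lp.coeFn_neg (cutL2 hS v)] with x h1 h2 h3 h4
    rw [h1, h4, Pi.neg_apply, h2]
    by_cases hx : x ∈ Set.Iio a
    · rw [Set.indicator_of_mem hx, Set.indicator_of_mem hx, h3, Pi.neg_apply]
    · rw [Set.indicator_of_notMem hx, Set.indicator_of_notMem hx, neg_zero]
  have hcg : IsW22 X (cutL2 hS u) (cutL2 hS g) (-cutL2 hS v) :=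
    ⟨hg.weak_deriv.cutL2 hS hfr, hneg ▸ hg.weak_deriv_two.cutL2 hS hfr⟩
  have hin : ∀ w : L2R, ∀ᵐ x, x ∈ Set.Iio a → cutL2 hS w x = w x := fun w => by
    filter_upwards [coeFn_cutL2 hS w] with x hx hxa
    rw [hx, Set.indicator_of_mem hxa]
  have hout : ∀ w : L2R, ∀ᵐ x, x ∈ Set.Ioi a → cutL2 hS w x = (0 : L2R) x := fun w => by
    filter_upwards [coeFn_cutL2 hS w, Lp.coeFn_zero ℂ 2 (volume : Measure ℝ)]
      with x hx hz hxa
    rw [hx, hz, Set.indicator_of_notMem (Set.notMem_Iio.2 (le_of_lt (Set.mem_Ioi.1 hxa)))]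
    rfl
  have right0 : ∀ w : L2R, rightValue (cutL2 hS w) a = 0 := fun w => by
    rw [rightValue_congr (lt_add_one a) ((hout w).mono fun y hy hya => hy hya.1),
      (values_zero a).1]
  have left_eq : ∀ w : L2R, leftValue (cutL2 hS w) a = leftValue w a := fun w =>
    leftValue_congr (sub_one_lt a) ((hin w).mono fun y hy hya => hy hya.2)
  -- The Wronskian with the truncation is the old one left of `a` and zero right of it; at `a` its
  -- left limit is zero because both derivatives vanish there.
  refine hA.mem_graph_of_wronskian_eq hX hcg fun p q k hpq hk y hy => ?_
  rw [wronskianRight, wronskianLeft]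
  rcases lt_trichotomy y a with hya | rfl | hya
  · obtain ⟨h1, h2⟩ := values_congr isOpen_Iio hya (hin u)
    obtain ⟨h3, h4⟩ := values_congr isOpen_Iio hya (hin g)
    rw [h1, h2, h3, h4]
    exact hA.wronskian_eq hX hpq hk huv hg y
  · rw [right0, right0, left_eq, left_eq, hl u v g huv hg, hl p q k hpq hk]
    simp
  · obtain ⟨h1, h2⟩ := values_congr isOpen_Ioi hya (hout u)
    obtain ⟨h3, h4⟩ := values_congr isOpen_Ioi hya (hout g)
    rw [h1, h2, h3, h4, (values_zero y).1, (values_zero y).2]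
    simp

/-- As `A` does not split, some `u₀` has nonzero derivative at `a`; the Wronskian identity with `u₀`
fixes the ratio of jump to derivative for all functions at once. -/
theorem exists_intensity (hX : X.Finite) (hA : IsLocalInteraction X A)
    (hcut : ∀ χ : ℝ → ℂ, IsCutoff X χ → MemDomain A χ) {a : ℝ} (ha : a ∈ X)
    (hs : ¬SplitsAt A a) :
    ∃ β : ℝ, ∀ u v g, (u, v) ∈ A.graph → IsW22 X u g (-v) →
      rightValue u a - leftValue u a = β * rightValue g a := by
  have hcont : ∀ {u v g}, (u, v) ∈ A.graph → IsW22 X u g (-v) →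
      rightValue g a = leftValue g a := fun huv hg =>
    hA.rightValue_deriv_eq_leftValue_deriv hX hcut huv hg a
  have hex : ∃ u v g, (u, v) ∈ A.graph ∧ IsW22 X u g (-v) ∧ leftValue g a ≠ 0 := by
    by_contra! hc
    exact hs (hA.splitsAt_of_rightValue_deriv_eq_zero hX ha hc)
  obtain ⟨u₀, v₀, g₀, huv₀, hg₀, hne⟩ := hex
  have key : ∀ {u v g}, (u, v) ∈ A.graph → IsW22 X u g (-v) →
      leftValue g a * conj (rightValue u₀ a - leftValue u₀ a) =
        (rightValue u a - leftValue u a) * conj (leftValue g₀ a) := by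
    intro u v g huv hg
    have := hA.wronskian_eq hX huv hg huv₀ hg₀ a
    rw [wronskianRight, wronskianLeft, hcont huv hg, hcont huv₀ hg₀] at this
    rw [map_sub]
    linear_combination this
  set D₀ := rightValue u₀ a - leftValue u₀ a
  set G₀ := leftValue g₀ a
  have hne' : conj G₀ ≠ 0 := (map_ne_zero _).2 hne
  -- Pairing `u₀` with itself makes the ratio real.
  have hreal : conj (D₀ / G₀) = D₀ / G₀ := by
    rw [map_div₀, div_eq_div_iff hne' hne]
    linear_combination key huv₀ hg₀
  refine ⟨(D₀ / G₀).re, fun u v g huv hg => ?_⟩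
  rw [Complex.conj_eq_iff_re.1 hreal, ← hreal, map_div₀, hcont huv hg, div_mul_eq_mul_div,
    eq_div_iff hne']
  linear_combination -key huv hg

theorem isDeltaPrimeInteraction (hX : X.Finite) (hA : IsLocalInteraction X A)
    (hcut : ∀ χ : ℝ → ℂ, IsCutoff X χ → MemDomain A χ) (hs : ∀ a, ¬SplitsAt A a) :
    IsDeltaPrimeInteraction X A := by
  have hβ : ∀ x, ∃ β : ℝ, x ∈ X → ∀ u v g, (u, v) ∈ A.graph → IsW22 X u g (-v) →
      rightValue u x - leftValue u x = β * rightValue g x := by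
    intro x
    by_cases hx : x ∈ X
    · obtain ⟨β, h⟩ := hA.exists_intensity hX hcut hx (hs x)
      exact ⟨β, fun _ => h⟩
    · exact ⟨0, fun h => absurd h hx⟩
  choose β hβ using hβ
  refine ⟨β, fun u v => ⟨fun huv => ?_, ?_⟩⟩
  · obtain ⟨g, hg⟩ := hA.exists_isW22 hX huv
    refine ⟨g, hg, fun x hx => ⟨_, _, _, _, hg.weak_deriv.hasRightValue hX x,
      hg.weak_deriv.hasLeftValue hX x, hg.weak_deriv_two.hasRightValue hX x,
      hg.weak_deriv_two.hasLeftValue hX x, ?_, ?_⟩⟩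
    · rw [hA.rightValue_deriv_eq_leftValue_deriv hX hcut huv hg x, sub_self]
    · rw [← hA.rightValue_deriv_eq_leftValue_deriv hX hcut huv hg x, add_self_div_two]
      exact hβ x hx u v g huv hg
  · rintro ⟨g, hg, hx⟩
    refine hA.mem_graph_of_wronskian_eq hX hg fun p q k hpq hk x hxX => ?_
    obtain ⟨u₁, u₀, g₁, g₀, h1, h2, h3, h4, hgg, huu⟩ := hx x hxX
    have hp := hβ x hxX p q k hpq hk
    have hkk := hA.rightValue_deriv_eq_leftValue_deriv hX hcut hpq hk x
    have hg1 : g₁ = g₀ := sub_eq_zero.1 hgg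
    rw [hg1, add_self_div_two] at huu
    have huc := congrArg conj huu
    rw [map_sub, map_mul, Complex.conj_ofReal] at huc
    rw [wronskianRight, wronskianLeft, h1.eq, h2.eq, h3.eq, h4.eq, hg1, ← hkk]
    -- Both functions have jump `β` times derivative; since `β` is real, the two contributions to
    -- the jump of the Wronskian cancel.
    linear_combination rightValue k x * huc - conj g₀ * hp

end IsLocalInteraction

/-! ### From the boundary conditions to the two conditions -/

theorem IsDeltaPrimeInteraction.exists_mem_graph (h : IsDeltaPrimeInteraction X A)
    {χ : ℝ → ℂ} (hχ : IsCutoff X χ) : ∃ u v : L2R, (u, v) ∈ A.graph ∧ u =ᵐ[volume] χ := by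
  obtain ⟨β, hβ⟩ := h
  have h0 := hχ.1.memLp.coeFn_toLp
  have h1 := hχ.1.deriv.memLp.coeFn_toLp
  have h2 := hχ.1.deriv.deriv.memLp.coeFn_toLp
  refine ⟨_, -hχ.1.deriv.deriv.memLp.toLp _, (hβ _ _).2 ⟨hχ.1.deriv.memLp.toLp _,
    ⟨isWeakDeriv_of_isTestFunction hχ.1 h0 h1, ?_⟩, fun x hx => ?_⟩, h0⟩
  · rw [neg_neg]
    exact isWeakDeriv_of_isTestFunction hχ.1.deriv h1 h2
  · have v1 := hasValues_of_continuous hχ.1.continuous h0 x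
    have v2 := hasValues_of_continuous hχ.1.deriv.continuous h1 x
    have d0 : deriv χ x = 0 :=
      image_eq_zero_of_notMem_tsupport fun hc => hχ.2.support_subset hc hx
    exact ⟨_, _, _, _, v1.1, v1.2, v2.1, v2.2, sub_self _, by simp [d0]⟩

/-- A cutoff equal to `1` near `a` and truncated at `a` has limits `1` and `0` there. On `X` its
derivative vanishes on both sides, so no finite `β` accounts for the jump; off `X` a jump
contradicts continuity. -/
theorem IsDeltaPrimeInteraction.not_splitsAt (hX : X.Finite) (h : IsDeltaPrimeInteraction X A)
    (a : ℝ) : ¬SplitsAt A a := by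
  intro hs
  obtain ⟨χ, hχ, h1, -⟩ := exists_isCutoff hX a
  obtain ⟨u, v, huv, hu⟩ := h.exists_mem_graph hχ
  obtain ⟨β, hβ⟩ := h
  have hS : MeasurableSet (Set.Iio a) := measurableSet_Iio
  obtain ⟨g, hg, hbc⟩ := (hβ _ _).1 (hs.cutL2_mem_graph huv)
  have hχ' := hχ.1.deriv.memLp.coeFn_toLp
  have hud := isWeakDeriv_of_isTestFunction (X := X) hχ.1 hu hχ'
  have hr : ∀ᵐ x, x ∈ Set.Ioi a → cutL2 hS u x = (0 : L2R) x := by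
    filter_upwards [coeFn_cutL2 hS u, Lp.coeFn_zero ℂ 2 (volume : Measure ℝ)] with x hx hz hxa
    rw [hx, hz, Set.indicator_of_notMem (Set.notMem_Iio.2 (le_of_lt (Set.mem_Ioi.1 hxa)))]
    rfl
  have hl : ∀ᵐ x, x ∈ Set.Iio a → cutL2 hS u x = u x := by
    filter_upwards [coeFn_cutL2 hS u] with x hx hxa
    rw [hx, Set.indicator_of_mem hxa]
  have hgr := hg.weak_deriv.ae_eq hX (isWeakDeriv_zero X) isOpen_Ioi hr
  have hgl := hg.weak_deriv.ae_eq hX hud isOpen_Iio hl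
  have vr : rightValue (cutL2 hS u) a = 0 := by
    rw [rightValue_congr (lt_add_one a) (hr.mono fun y hy hya => hy hya.1), (values_zero a).1]
  have vl : leftValue (cutL2 hS u) a = 1 := by
    rw [leftValue_congr (sub_one_lt a) (hl.mono fun y hy hya => hy hya.2),
      (hasValues_of_continuous hχ.1.continuous hu a).2.eq, h1.self_of_nhds]
  by_cases ha : a ∈ X
  · have dr : rightValue g a = 0 := by
      rw [rightValue_congr (lt_add_one a) (hgr.mono fun y hy hya => hy hya.1), (values_zero a).1]
    have dl : leftValue g a = 0 := by
      rw [leftValue_congr (sub_one_lt a) (hgl.mono fun y hy hya => hy hya.2),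
        (hasValues_of_continuous hχ.1.deriv.continuous hχ' a).2.eq]
      exact image_eq_zero_of_notMem_tsupport fun hc => hχ.2.support_subset hc ha
    obtain ⟨u₁, u₀, g₁, g₀, e1, e2, e3, e4, -, huu⟩ := hbc a ha
    rw [← e1.eq, ← e2.eq, ← e3.eq, ← e4.eq, vr, vl, dr, dl] at huu
    simp at huu
  · have := hg.weak_deriv.rightValue_eq_leftValue hX ha
    rw [vr, vl] at this
    exact zero_ne_one this

end PointInteraction

theorem proposition1 (X : Set ℝ) (hX : X.Finite)
    (A : PointInteraction.L2R →ₗ.[ℂ] PointInteraction.L2R)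
    (hA : PointInteraction.IsLocalInteraction X A) :
    PointInteraction.IsDeltaPrimeInteraction X A ↔
      (∀ χ : ℝ → ℂ, PointInteraction.IsCutoff X χ → PointInteraction.MemDomain A χ) ∧
      (∀ a : ℝ, ¬ PointInteraction.SplitsAt A a) := by
  refine ⟨fun h => ⟨fun χ hχ => ?_, h.not_splitsAt hX⟩,
    fun h => hA.isDeltaPrimeInteraction hX h.1 h.2⟩
  obtain ⟨u, v, huv, hu⟩ := h.exists_mem_graph hχ
  exact ⟨u, LinearPMap.mem_domain_of_mem_graph huv, hu⟩
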